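/- Let $\Omega\subset\mathbb{R}^d$ be a bounded open set (for instance a bounded Lipschitz domain, $d\in\{1,2,3\}$), $0<\alpha<1$, $T>0$, $r\ge 1$, $K>0$, and let $p\ge 0$ be an integer. Write $\langle\cdot,\cdot\rangle$, $\|\cdot\|$ for the inner product and norm of $L^2(\Omega)$, $\omega_\beta(t)=t^{\beta-1}/\Gamma(\beta)$, and ${}_a\partial_t^{\alpha}v(t)=\frac{d}{dt}\int_a^t\omega_{1-\alpha}(t-s)v(s)\,ds$ for the Riemann–Liouville derivative, $\partial_t^\alpha={}_0\partial_t^\alpha$. For $N\ge1$ let $t_n=(n/N)^rT$ ($0\le n\le N$), $I_n=(t_{n-1},t_n]$, $\tau_n=t_n-t_{n-1}$, and let $\mathcal{P}_p(H_0^1(\Omega))$ be the space of polynomials in $t$ of degree at most $p$ with coefficients in $H_0^1(\Omega)$. Let $u_0\in L^2(\Omega)$ and $f\in L^2((0,T);L^2(\Omega))$. The DG solution $U:(0,T]\to H_0^1(\Omega)$ is such that, for $1\le n\le N$, $U|_{I_n}\in\mathcal{P}_p(H_0^1(\Omega))$ and $$\int_{I_n}\big[\langle\partial_t^\alpha U,X\rangle+\langle\nabla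 U,\nabla X\rangle\big]dt=\int_{I_n}\langle f+\omega_{1-\alpha}(t)u_0,X\rangle\,dt\qquad\forall X\in\mathcal{P}_p(H_0^1(\Omega)).$$ Let $\varepsilon>0$, and let $w_j,\lambda_j\in\mathbb{R}$ ($1\le j\le Q$) satisfy $$\Big|\omega_{-\alpha}(t)-\sum_{j=1}^Q w_je^{-\lambda_jt}\Big|\le K\varepsilon\,|\omega_{-\alpha}(t)|,\qquad t\in[t_1,T].$$ The fast DG solution ${}_FU:(0,T]\to H_0^1(\Omega)$ equals $U$ on $I_1$ and $I_2$ and, for $3\le n\le N$, satisfies ${}_FU|_{I_n}\in\mathcal{P}_p(H_0^1(\Omega))$ and $$\int_{I_n}\langle{}_{t_{n-2}}\partial_t^\alpha\,{}_FU,X\rangle\,dt+\sum_{j=1}^Qw_je^{-\lambda_j\tau_{n-1}}\langle\psi_j^n(X),Y_j(t_{n-2})\rangle+\int_{I_n}\langle\nabla{}_FU,\nabla X\rangle\,dt=\int_{I_n}\langle f+\omega_{1-\alpha}(t)u_0,X\rangle\,dt$$ for all $X\in\mathcal{P}_p(H_0^1(\Omega))$, where $Y_j(t)=\int_0^te^{-\lambda_j(t-s)}{}_FU(s)\,ds$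 and $\psi_j^n(X)=\int_{I_n}e^{-\lambda_j(t-t_{n-1})}X(t)\,dt$. Then there is a constant $c>0$, depending only on $\Omega,\alpha,r,T,K,p$, such that for all $u_0,f$ as above there is a constant $C>0$, depending only on $\Omega,\alpha,r,T,K,p,u_0,f$ (hence independent of $N$, $n$, $\varepsilon$, $Q$, $w_j$, $\lambda_j$), with the following property: whenever $0<\varepsilon\le cN^{-r\alpha}$ and $U$, ${}_FU$ are as above, for all $1\le n\le N$, $$\int_0^{t_n}\|U(t)-{}_FU(t)\|^2\,dt\le C\,(\varepsilon\,t_n^{\alpha}t_1^{-\alpha})^2\qquad\text{and}\qquad(\varepsilon\,t_n^{\alpha}t_1^{-\alpha})^2\le C\,(\varepsilon\,n^{r\alpha})^2 .$$ -/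

import Mathlib

noncomputable section

namespace FastDG

open MeasureTheory

/-! ## The spatial spaces -/

/-- The real Hilbert space `L²(Ω)`, with its inner product and its norm. -/
abbrev L2 {d : ℕ} (Ω : Set (EuclideanSpace ℝ (Fin d))) : Type :=
  Lp ℝ 2 (volume.restrict Ω)

/-- The real Hilbert space `L²(Ω; ℝᵈ)`. -/
abbrev L2Vec {d : ℕ} (Ω : Set (EuclideanSpace ℝ (Fin d))) : Type :=
  Lp (EuclideanSpace ℝ (Fin d)) 2 (volume.restrict Ω)

/-- The space of all pairs `(φ, ∇φ)`, for `φ` smooth with compact support contained in `Ω`. -/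
def testGraph {d : ℕ} (Ω : Set (EuclideanSpace ℝ (Fin d))) :
    Submodule ℝ (L2 Ω × L2Vec Ω) where
  carrier := {z | ∃ φ : EuclideanSpace ℝ (Fin d) → ℝ,
    ContDiff ℝ ((⊤ : ℕ∞) : WithTop ℕ∞) φ ∧ HasCompactSupport φ ∧ tsupport φ ⊆ Ω ∧
    z.1 =ᵐ[volume.restrict Ω] φ ∧ z.2 =ᵐ[volume.restrict Ω] gradient φ}
  add_mem' := by
    rintro a b ⟨φ, h1, h2, h3, h4, h5⟩ ⟨ψ, g1, g2, g3, g4, g5⟩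
    refine ⟨φ + ψ, h1.add g1, h2.add g2, (tsupport_add φ ψ).trans (Set.union_subset h3 g3), ?_, ?_⟩
    · filter_upwards [Lp.coeFn_add a.1 b.1, h4, g4] with x e1 e2 e3
      rw [Prod.fst_add, e1, Pi.add_apply, Pi.add_apply, e2, e3]
    · filter_upwards [Lp.coeFn_add a.2 b.2, h5, g5] with x e1 e2 e3
      rw [Prod.snd_add, e1, Pi.add_apply, e2, e3]
      simp only [gradient]
      rw [fderiv_add (h1.differentiable (by simp) x) (g1.differentiable (by simp) x), map_add]
  zero_mem' := by
    refine ⟨0, contDiff_const, HasCompactSupport.zero, by simp, ?_, ?_⟩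
    · exact Lp.coeFn_zero _ _ _
    · filter_upwards [Lp.coeFn_zero (EuclideanSpace ℝ (Fin d)) 2 (volume.restrict Ω)] with x hx
      rw [Prod.snd_zero, hx]
      simp [gradient]
  smul_mem' := by
    rintro c a ⟨φ, h1, h2, h3, h4, h5⟩
    refine ⟨c • φ, contDiff_const.smul h1, h2.smul_left (f := fun _ => c),
      (closure_mono (Function.support_const_smul_subset c φ)).trans h3, ?_, ?_⟩
    · filter_upwards [Lp.coeFn_smul c a.1, h4] with x e1 e2
      rw [Prod.smul_fst, e1, Pi.smul_apply, Pi.smul_apply, e2]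
    · filter_upwards [Lp.coeFn_smul c a.2, h5] with x e1 e2
      rw [Prod.smul_snd, e1, Pi.smul_apply, e2]
      simp only [gradient]
      rw [fderiv_const_smul (h1.differentiable (by simp) x) c]
      simp

/-- The Sobolev space `H₀¹(Ω)`, the closure of `C_c^∞(Ω)` in the `H¹` norm. A function `v` in it is
represented by the pair `(v, ∇v)`, so the closure in the `H¹` norm is the closure of the pairs
`(φ, ∇φ)` in `L²(Ω) × L²(Ω; ℝᵈ)`. -/
def H01 {d : ℕ} (Ω : Set (EuclideanSpace ℝ (Fin d))) : Submodule ℝ (L2 Ω × L2Vec Ω) :=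
  (testGraph Ω).topologicalClosure

/-- The embedding of `H₀¹(Ω)` into `L²(Ω)`. -/
def toL2 {d : ℕ} {Ω : Set (EuclideanSpace ℝ (Fin d))} (v : H01 Ω) : L2 Ω :=
  (v : L2 Ω × L2Vec Ω).1

/-- The weak gradient of an element of `H₀¹(Ω)`. -/
def grad {d : ℕ} {Ω : Set (EuclideanSpace ℝ (Fin d))} (v : H01 Ω) : L2Vec Ω :=
  (v : L2 Ω × L2Vec Ω).2

/-! ## Time mesh, polynomials in time, fractional derivative -/

/-- The mesh points `t_n = (n / N)^r T`. -/
def mesh (r T : ℝ) (N n : ℕ) : ℝ := ((n : ℝ) / (N : ℝ)) ^ r * T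

/-- The subinterval `I_n = (t_{n-1}, t_n]`, for `n ≥ 1`. -/
def cell (r T : ℝ) (N n : ℕ) : Set ℝ := Set.Ioc (mesh r T N (n - 1)) (mesh r T N n)

/-- On the set `I`, the function `v` is a polynomial in time of degree at most `p`, with
coefficients in `S`: the space `P_p(S)` on `I`. -/
def IsPolyOn {S : Type*} [AddCommGroup S] [Module ℝ S] (p : ℕ) (I : Set ℝ) (v : ℝ → S) : Prop :=
  ∃ a : ℕ → S, ∀ t ∈ I, v t = ∑ i ∈ Finset.range (p + 1), t ^ i • a i

/-- The kernel `ω_β(t) = t^{β-1} / Γ(β)`, for `t > 0`. -/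
def omega (β t : ℝ) : ℝ := t ^ (β - 1) / Real.Gamma β

/-- The left Riemann-Liouville derivative of order `α ∈ (0,1)` with base point `a`,
`(d/dt) ∫_a^t ω_{1-α}(t-s) u(s) ds`. -/
def rlDeriv {E : Type*} [NormedAddCommGroup E] [NormedSpace ℝ E] (α a : ℝ) (u : ℝ → E) (t : ℝ) :
    E :=
  deriv (fun x : ℝ => ∫ s in a..x, omega (1 - α) (x - s) • u s) t

/-! ## The two schemes -/

/-- The right-hand side `∫_{I_n} ⟨f + ω_{1-α}(t) u₀, X⟩ dt`. -/
def load {d : ℕ} {Ω : Set (EuclideanSpace ℝ (Fin d))} (α r T : ℝ) (N n : ℕ)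
    (u₀ : L2 Ω) (f : ℝ → L2 Ω) (X : ℝ → H01 Ω) : ℝ :=
  ∫ t in mesh r T N (n - 1)..mesh r T N n, inner ℝ (f t + omega (1 - α) t • u₀) (toL2 (X t))

/-- `U` is the semi-discrete time-stepping DG solution on `(0, T]`: on each `I_n` it is a polynomial
of degree at most `p` with coefficients in `H₀¹(Ω)`, and the variational equation on `I_n` holds. -/
def IsDG {d : ℕ} {Ω : Set (EuclideanSpace ℝ (Fin d))} (α r T : ℝ) (p N : ℕ)
    (u₀ : L2 Ω) (f : ℝ → L2 Ω) (U : ℝ → H01 Ω) : Prop :=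
  (∀ n : ℕ, 1 ≤ n → n ≤ N → IsPolyOn p (cell r T N n) U) ∧
  ∀ n : ℕ, 1 ≤ n → n ≤ N → ∀ X : ℝ → H01 Ω, IsPolyOn p (cell r T N n) X →
    (∫ t in mesh r T N (n - 1)..mesh r T N n,
        (inner ℝ (rlDeriv α 0 (fun s => toL2 (U s)) t) (toL2 (X t))
          + inner ℝ (grad (U t)) (grad (X t))))
      = load α r T N n u₀ f X

/-- The exponential sum `∑_j w_j e^{-λ_j t}` approximates `ω_{-α}(t)` on `[δ, T]` with relative
error at most `η`. -/
def KernelApprox (α δ T η : ℝ) {Q : ℕ} (w lam : Fin Q → ℝ) : Prop :=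
  ∀ t : ℝ, δ ≤ t → t ≤ T →
    |omega (-α) t - ∑ j, w j * Real.exp (-(lam j) * t)| ≤ η * |omega (-α) t|

/-- The local part `L^{α,n}(V, X) = ∫_{I_n} ⟨_{t_{n-2}}∂_t^α V, X⟩ dt`, for `n ≥ 2`. -/
def localPart {d : ℕ} {Ω : Set (EuclideanSpace ℝ (Fin d))} (α r T : ℝ) (N n : ℕ)
    (V X : ℝ → H01 Ω) : ℝ :=
  ∫ t in mesh r T N (n - 1)..mesh r T N n,
    inner ℝ (rlDeriv α (mesh r T N (n - 2)) (fun s => toL2 (V s)) t) (toL2 (X t))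

/-- The history variable `Y(t) = ∫_0^t e^{-μ(t-s)} V(s) ds`, which solves `Y' = -μ Y + V`,
`Y(0) = 0`. -/
def histVar {d : ℕ} {Ω : Set (EuclideanSpace ℝ (Fin d))} (μ : ℝ) (V : ℝ → H01 Ω) (t : ℝ) : L2 Ω :=
  ∫ s in (0 : ℝ)..t, Real.exp (-μ * (t - s)) • toL2 (V s)

/-- `ψ^n(X) = ∫_{I_n} X(t) e^{-μ(t-t_{n-1})} dt`. -/
def testMoment {d : ℕ} {Ω : Set (EuclideanSpace ℝ (Fin d))} (r T : ℝ) (N n : ℕ) (μ : ℝ)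
    (X : ℝ → H01 Ω) : L2 Ω :=
  ∫ t in mesh r T N (n - 1)..mesh r T N n,
    Real.exp (-μ * (t - mesh r T N (n - 1))) • toL2 (X t)

/-- The fast history part
`_FH^{α,n}(V, X) = ∑_j w_j e^{-λ_j τ_{n-1}} ⟨ψ_j^n(X), Y_j(t_{n-2})⟩`, for `n ≥ 2`. -/
def fastHist {d : ℕ} {Ω : Set (EuclideanSpace ℝ (Fin d))} (r T : ℝ) (N n : ℕ) {Q : ℕ}
    (w lam : Fin Q → ℝ) (V X : ℝ → H01 Ω) : ℝ :=
  ∑ j, w j * Real.exp (-(lam j) * (mesh r T N (n - 1) - mesh r T N (n - 2))) *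
    inner ℝ (testMoment r T N n (lam j) X) (histVar (lam j) V (mesh r T N (n - 2)))

/-- `V` is the semi-discrete fast time-stepping DG solution on `(0, T]`, started from the DG
solution `U`: `V = U` on `I_1` and `I_2`, and on `I_n` with `n ≥ 3` the function `V` is a polynomial
of degree at most `p` with coefficients in `H₀¹(Ω)` that satisfies the DG equation in which the
memory term is the sum of the local part and the fast history part. -/
def IsFastDG {d : ℕ} {Ω : Set (EuclideanSpace ℝ (Fin d))} (α r T : ℝ) (p N : ℕ)
    (u₀ : L2 Ω) (f : ℝ → L2 Ω) {Q : ℕ} (w lam : Fin Q → ℝ) (U V : ℝ → H01 Ω) : Prop :=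
  (∀ n : ℕ, 1 ≤ n → n ≤ N → n ≤ 2 → ∀ t ∈ cell r T N n, V t = U t) ∧
  (∀ n : ℕ, 3 ≤ n → n ≤ N → IsPolyOn p (cell r T N n) V) ∧
  ∀ n : ℕ, 3 ≤ n → n ≤ N → ∀ X : ℝ → H01 Ω, IsPolyOn p (cell r T N n) X →
    (localPart α r T N n V X + fastHist r T N n w lam V X)
        + (∫ t in mesh r T N (n - 1)..mesh r T N n, inner ℝ (grad (V t)) (grad (X t)))
      = load α r T N n u₀ f X

end FastDG

end

/-! The proof is an energy argument for `e = U - V`, where `V` is the fast solution. Beyond the last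
two cells the memory term is a convolution with `ω_{-α}` over `(0, t_{n-2}]`. Because exponentials
factor, the moments and history variables of the fast scheme are exactly the same convolution with
the exponential sum as kernel. Testing the difference of the schemes with `e` therefore leaves
`∫⟨∂^α e, e⟩` plus a nonnegative gradient term on one side. On the other side stands only the kernel
error acting on the past of `V`. Superadditivity of `x ↦ x^r` keeps all lags there at least `t_1`,
so the relative kernel bound always applies.

Two estimates close the argument. Coercivity: `2∫_0^{t_n}⟨∂^α e, e⟩ ≥ κ ∫_0^{t_n}‖e‖²` with `κ =
ω_{1-α}(t_n)`. It follows from a pointwise inequality, which is an extremum principle applied to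
`‖e(·) - e(t)‖²`: a nonnegative function that vanishes at `t` and is differentiable there has a
nonpositive Riemann–Liouville derivative at `t`. Perturbation: `|ω_{-α}|` has mass `ω_{1-α}(t_1)` on
`[t_1, ∞)`, so a weighted Young inequality bounds the error term by `ρ = Kε ω_{1-α}(t_1)` times `L²`
norms of `V` and `e`.

If `ρ/κ` is small, which is what `ε ≤ cN^{-rα}` ensures, the terms in `e` are absorbed and `∫‖e‖² ≤
(4ρ/κ)² ∫‖U‖²`. Here `ρ/κ = Kε t_n^α t_1^{-α}`, and `∫‖U‖²` is bounded by the data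
(`PiecewisePoly.stability`), independently of the mesh. The second inequality rests on the identity
`t_n^α t_1^{-α} = n^{rα}`.

The analytic input is that fractional integrals of piecewise polynomials are sums of truncated
powers (`PiecewisePoly.fracRegular`), hence continuous, with an integrable derivative off the mesh
points. The carrying lemmas are `deriv_fracInt_nonpos_of_min`,
`PiecewisePoly.integral_inner_rlDeriv_ge`, `cell_energy_le` and `integral_normSq_sub_le`. -/

namespace FastDG

open MeasureTheory Set Filter Topology

/-! ## The fractional integral of order `1 - α` -/

/-- The Riemann-Liouville integral `∫_0^x ω_{1-α}(x-s) v(s) ds`. -/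
noncomputable def fracInt {E : Type*} [NormedAddCommGroup E] [NormedSpace ℝ E] (α : ℝ) (v : ℝ → E)
    (x : ℝ) : E :=
  ∫ s in (0 : ℝ)..x, omega (1 - α) (x - s) • v s

theorem rlDeriv_zero {E : Type*} [NormedAddCommGroup E] [NormedSpace ℝ E] (α : ℝ) (v : ℝ → E)
    (t : ℝ) : rlDeriv α 0 v t = deriv (fracInt α v) t := rfl

theorem omega_eq (α t : ℝ) : omega (1 - α) t = t ^ (-α) / Real.Gamma (1 - α) := by
  rw [omega]; congr 2; ring

theorem omega_nonneg {α : ℝ} (hα : α < 1) {t : ℝ} (ht : 0 ≤ t) : 0 ≤ omega (1 - α) t := by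
  rw [omega_eq]
  exact div_nonneg (Real.rpow_nonneg ht _) (Real.Gamma_pos_of_pos (by linarith)).le

theorem omega_anti {α : ℝ} (hα0 : 0 < α) (hα : α < 1) {s t : ℝ} (hs : 0 < s) (hst : s ≤ t) :
    omega (1 - α) t ≤ omega (1 - α) s := by
  rw [omega_eq, omega_eq]
  exact div_le_div_of_nonneg_right (Real.rpow_le_rpow_of_nonpos hs hst (by linarith))
    (Real.Gamma_pos_of_pos (by linarith)).le

theorem intervalIntegrable_omega {α : ℝ} (hα : α < 1) (a b : ℝ) :
    IntervalIntegrable (fun s => omega (1 - α) s) volume a b := by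
  simp only [omega_eq]
  exact (intervalIntegral.intervalIntegrable_rpow' (by linarith)).div_const _

theorem intervalIntegrable_omega_sub {α : ℝ} (hα : α < 1) (x a b : ℝ) :
    IntervalIntegrable (fun s => omega (1 - α) (x - s)) volume a b := by
  simpa using (intervalIntegrable_omega hα (x - a) (x - b)).comp_sub_left x

theorem integral_omega {α : ℝ} (hα : α < 1) (b : ℝ) :
    ∫ s in (0 : ℝ)..b, omega (1 - α) s = b ^ (1 - α) / ((1 - α) * Real.Gamma (1 - α)) := by
  simp only [omega_eq]
  rw [intervalIntegral.integral_div, integral_rpow (Or.inl (by linarith)),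
    Real.zero_rpow (by linarith), show -α + 1 = 1 - α by ring, sub_zero, div_div]

/-- Functions on `(0, b]` that are bounded and measurable, and whose fractional integral is
continuous and, off `B`, differentiable with an integrable derivative. -/
structure FracRegular {E : Type*} [NormedAddCommGroup E] [NormedSpace ℝ E] (α b : ℝ) (B : Set ℝ)
    (v : ℝ → E) : Prop where
  bdd : ∃ M, ∀ t ∈ Ioc 0 b, ‖v t‖ ≤ M
  meas : AEStronglyMeasurable v (volume.restrict (Ioc 0 b))
  cont : ContinuousOn (fracInt α v) (Icc 0 b)
  deriv : ∃ g : ℝ → E, (∀ t ∈ Ioo 0 b, t ∉ B → HasDerivAt (fracInt α v) (g t) t) ∧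
    IntervalIntegrable g volume 0 b

section Regular

variable {E : Type*} [NormedAddCommGroup E] [NormedSpace ℝ E] {α b : ℝ} {B : Set ℝ}

theorem integrableOn_smul_of_bdd {φ : ℝ → ℝ} {v : ℝ → E} {S : Set ℝ} (hS : MeasurableSet S)
    (hφ : IntegrableOn φ S) (hb : ∃ M, ∀ t ∈ S, ‖v t‖ ≤ M)
    (hm : AEStronglyMeasurable v (volume.restrict S)) :
    IntegrableOn (fun s => φ s • v s) S := by
  obtain ⟨M, hM⟩ := hb
  exact Integrable.smul_bdd hφ hm (C := M) (by
    filter_upwards [ae_restrict_mem hS] with t ht using hM t ht)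

theorem intervalIntegrable_omega_smul {v : ℝ → E} (hα : α < 1)
    (hb : ∃ M, ∀ t ∈ Ioc 0 b, ‖v t‖ ≤ M)
    (hm : AEStronglyMeasurable v (volume.restrict (Ioc 0 b))) (y : ℝ) {x : ℝ} (hx : x ∈ Icc 0 b) :
    IntervalIntegrable (fun s => omega (1 - α) (y - s) • v s) volume 0 x := by
  rw [intervalIntegrable_iff_integrableOn_Ioc_of_le hx.1]
  have hsub : Ioc 0 x ⊆ Ioc 0 b := Ioc_subset_Ioc_right hx.2
  refine integrableOn_smul_of_bdd measurableSet_Ioc ?_ ?_ (hm.mono_set hsub)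
  · exact (intervalIntegrable_iff_integrableOn_Ioc_of_le hx.1).1
      (intervalIntegrable_omega_sub hα y 0 x)
  · obtain ⟨M, hM⟩ := hb
    exact ⟨M, fun t ht => hM t (hsub ht)⟩

theorem fracInt_congr {v w : ℝ → E} (h : ∀ t ∈ Ioc 0 b, v t = w t) {x : ℝ} (hx : x ∈ Icc 0 b) :
    fracInt α v x = fracInt α w x := by
  refine intervalIntegral.integral_congr_ae (ae_of_all _ fun s hs => ?_)
  rw [uIoc_of_le hx.1] at hs
  rw [h s ⟨hs.1, hs.2.trans hx.2⟩]

theorem FracRegular.congr {v w : ℝ → E} (hv : FracRegular α b B v)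
    (h : ∀ t ∈ Ioc 0 b, w t = v t) : FracRegular α b B w where
  bdd := by
    obtain ⟨M, hM⟩ := hv.bdd
    exact ⟨M, fun t ht => by rw [h t ht]; exact hM t ht⟩
  meas := hv.meas.congr (by
    filter_upwards [ae_restrict_mem measurableSet_Ioc] with t ht using (h t ht).symm)
  cont := hv.cont.congr fun x hx => fracInt_congr h hx
  deriv := by
    obtain ⟨g, hg, hi⟩ := hv.deriv
    refine ⟨g, fun t ht htB => (hg t ht htB).congr_of_eventuallyEq ?_, hi⟩
    filter_upwards [Ioo_mem_nhds ht.1 ht.2] with x hx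
    exact fracInt_congr h (Ioo_subset_Icc_self hx)

theorem fracInt_add {v w : ℝ → E} (hα : α < 1) (hv : FracRegular α b B v)
    (hw : FracRegular α b B w) {x : ℝ} (hx : x ∈ Icc 0 b) :
    fracInt α (fun t => v t + w t) x = fracInt α v x + fracInt α w x := by
  simp only [fracInt, smul_add]
  exact intervalIntegral.integral_add (intervalIntegrable_omega_smul hα hv.bdd hv.meas x hx)
    (intervalIntegrable_omega_smul hα hw.bdd hw.meas x hx)

theorem fracInt_const_smul (k : ℝ) (v : ℝ → E) (x : ℝ) :
    fracInt α (fun t => k • v t) x = k • fracInt α v x := by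
  simp only [fracInt]
  rw [← intervalIntegral.integral_smul]
  simp only [smul_comm k]

theorem FracRegular.add {v w : ℝ → E} (hα : α < 1) (hv : FracRegular α b B v)
    (hw : FracRegular α b B w) : FracRegular α b B (fun t => v t + w t) where
  bdd := by
    obtain ⟨M, hM⟩ := hv.bdd
    obtain ⟨M', hM'⟩ := hw.bdd
    exact ⟨M + M', fun t ht => (norm_add_le _ _).trans (add_le_add (hM t ht) (hM' t ht))⟩
  meas := hv.meas.add hw.meas
  cont := (hv.cont.add hw.cont).congr fun x hx => fracInt_add hα hv hw hx
  deriv := by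
    obtain ⟨g, hg, hi⟩ := hv.deriv
    obtain ⟨g', hg', hi'⟩ := hw.deriv
    refine ⟨fun t => g t + g' t, fun t ht htB => ?_, hi.add hi'⟩
    refine ((hg t ht htB).add (hg' t ht htB)).congr_of_eventuallyEq ?_
    filter_upwards [Ioo_mem_nhds ht.1 ht.2] with x hx
    exact fracInt_add hα hv hw (Ioo_subset_Icc_self hx)

theorem FracRegular.const_smul (k : ℝ) {v : ℝ → E} (hv : FracRegular α b B v) :
    FracRegular α b B (fun t => k • v t) where
  bdd := by
    obtain ⟨M, hM⟩ := hv.bdd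
    exact ⟨‖k‖ * M, fun t ht => by
      rw [norm_smul]; exact mul_le_mul_of_nonneg_left (hM t ht) (norm_nonneg _)⟩
  meas := hv.meas.const_smul k
  cont := (hv.cont.const_smul k).congr fun x _ => fracInt_const_smul k v x
  deriv := by
    obtain ⟨g, hg, hi⟩ := hv.deriv
    refine ⟨fun t => k • g t, fun t ht htB => ?_, hi.smul k⟩
    refine ((hg t ht htB).const_smul k).congr_of_eventuallyEq (Eventually.of_forall fun x => ?_)
    exact fracInt_const_smul k v x

theorem FracRegular.zero : FracRegular α b B (fun _ => (0 : E)) where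
  bdd := ⟨0, by simp⟩
  meas := aestronglyMeasurable_const
  cont := by
    have : fracInt α (fun _ => (0 : E)) = fun _ => 0 := by ext; simp [fracInt]
    rw [this]; exact continuousOn_const
  deriv := by
    have : fracInt α (fun _ => (0 : E)) = fun _ => 0 := by ext; simp [fracInt]
    exact ⟨fun _ => 0, fun t _ _ => by rw [this]; exact hasDerivAt_const _ _, by simp⟩

theorem FracRegular.sum {ι : Type*} (hα : α < 1) (s : Finset ι) {v : ι → ℝ → E}
    (hv : ∀ i ∈ s, FracRegular α b B (v i)) : FracRegular α b B (fun t => ∑ i ∈ s, v i t) := by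
  classical
  induction s using Finset.induction_on with
  | empty => simpa using FracRegular.zero
  | insert i s hi ih =>
    simp only [Finset.sum_insert hi]
    exact (hv i (Finset.mem_insert_self i s)).add hα
      (ih fun j hj => hv j (Finset.mem_insert_of_mem hj))

/-- The fractional integral of a truncated power is a truncated power. -/
theorem fracInt_truncPow [CompleteSpace E] (hα : α < 1) {a : ℝ} (ha : 0 ≤ a) (k : ℕ) (c : E)
    {x : ℝ} (hx : 0 ≤ x) :
    fracInt α ((Ioi a).indicator fun t => (t - a) ^ k • c) x =
      (max (x - a) 0) ^ ((k : ℝ) + 1 - α) •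
        ((∫ y in (0 : ℝ)..1, omega (1 - α) (1 - y) * y ^ k) • c) := by
  have hexp : (k : ℝ) + 1 - α ≠ 0 := by
    have : (0 : ℝ) ≤ k := k.cast_nonneg
    linarith
  have h1 : fracInt α ((Ioi a).indicator fun t => (t - a) ^ k • c) x =
      ∫ s in Ioc 0 x ∩ Ioi a, omega (1 - α) (x - s) • (s - a) ^ k • c := by
    rw [fracInt, intervalIntegral.integral_of_le hx, ← setIntegral_indicator measurableSet_Ioi]
    refine integral_congr_ae (ae_of_all _ fun s => ?_)
    by_cases hs : s ∈ Ioi a <;> simp [hs, indicator]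
  rw [h1]
  rcases le_or_gt x a with hxa | hxa
  · have : Ioc 0 x ∩ Ioi a = ∅ := by
      ext s; simp only [mem_inter_iff, mem_Ioc, mem_Ioi, mem_empty_iff_false, iff_false]
      rintro ⟨⟨_, h⟩, h'⟩; linarith
    rw [this, max_eq_right (by linarith), Real.zero_rpow hexp]; simp
  · have : Ioc 0 x ∩ Ioi a = Ioc a x := by
      ext s; simp only [mem_inter_iff, mem_Ioc, mem_Ioi]
      constructor
      · rintro ⟨⟨_, h⟩, h'⟩; exact ⟨h', h⟩
      · rintro ⟨h, h'⟩; exact ⟨⟨by linarith, h'⟩, h⟩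
    have hp : 0 < x - a := by linarith
    rw [this, ← intervalIntegral.integral_of_le hxa.le, max_eq_left hp.le]
    simp only [smul_smul]
    rw [intervalIntegral.integral_smul_const]
    congr 1
    -- The substitution `s = a + (x - a) y` pulls out the power of `x - a` by homogeneity and leaves
    -- a Beta integral.
    have h2 := intervalIntegral.smul_integral_comp_add_mul
      (fun s => omega (1 - α) (x - s) * (s - a) ^ k) (x - a) a (a := 0) (b := 1)
    rw [mul_zero, add_zero, mul_one, add_sub_cancel] at h2
    rw [← h2, smul_eq_mul, ← intervalIntegral.integral_const_mul,
      ← intervalIntegral.integral_const_mul]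
    refine intervalIntegral.integral_congr fun y hy => ?_
    rw [uIcc_of_le zero_le_one] at hy
    simp only [omega_eq]
    rw [show x - (a + (x - a) * y) = (x - a) * (1 - y) by ring, Real.mul_rpow hp.le (by linarith [hy.2]),
      show (k : ℝ) + 1 - α = 1 + (-α) + k by ring, Real.rpow_add hp, Real.rpow_add hp,
      Real.rpow_one, Real.rpow_natCast, show a + (x - a) * y - a = (x - a) * y by ring, mul_pow]
    ring

/-- The explicit formula for the fractional integral gives everything. Its exponent `k + 1 - α` is
positive, hence continuity. Its derivative behaves like `(t - a)^(k - α)`, possibly singular at `a`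
but integrable because `α < 1`. This is why `a` has to lie in the exceptional set. -/
theorem FracRegular.truncPow_centered [CompleteSpace E] (hα : α < 1) {a : ℝ} (ha : 0 ≤ a)
    (haB : a ∈ B) (k : ℕ) (c : E) :
    FracRegular α b B ((Ioi a).indicator fun t => (t - a) ^ k • c) where
  bdd := by
    have hc : ContinuousOn (fun t : ℝ => (t - a) ^ k • c) (Icc 0 b) := by fun_prop
    obtain ⟨M, hM⟩ := isCompact_Icc.exists_bound_of_continuousOn hc
    exact ⟨M, fun t ht => (norm_indicator_le_norm_self _ _).trans (hM t (Ioc_subset_Icc_self ht))⟩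
  meas := by
    have hc : Continuous (fun t : ℝ => (t - a) ^ k • c) := by fun_prop
    exact (hc.aestronglyMeasurable).indicator measurableSet_Ioi
  cont := by
    refine ContinuousOn.congr ?_ fun x hx => fracInt_truncPow hα ha k c hx.1
    have hk : (0 : ℝ) ≤ k := k.cast_nonneg
    exact (((by fun_prop : Continuous fun x : ℝ => max (x - a) 0).rpow_const
      fun x => Or.inr (by linarith)).smul continuous_const).continuousOn
  deriv := by
    have hk : (0 : ℝ) ≤ k := k.cast_nonneg
    set C := (∫ y in (0 : ℝ)..1, omega (1 - α) (1 - y) * y ^ k) • c with hC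
    refine ⟨(Ioi a).indicator fun t => (((k : ℝ) + 1 - α) * (t - a) ^ ((k : ℝ) - α)) • C,
      fun t ht htB => ?_, ?_⟩
    · have heq : fracInt α ((Ioi a).indicator fun t => (t - a) ^ k • c) =ᶠ[𝓝 t]
          fun x => (max (x - a) 0) ^ ((k : ℝ) + 1 - α) • C := by
        filter_upwards [Ioi_mem_nhds ht.1] with x hx
        exact fracInt_truncPow hα ha k c (le_of_lt hx)
      refine HasDerivAt.congr_of_eventuallyEq ?_ heq
      rcases lt_trichotomy t a with hta | hta | hta
      · rw [indicator_of_notMem (by simpa using hta.le)]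
        refine (hasDerivAt_const t (0 : E)).congr_of_eventuallyEq ?_
        filter_upwards [Iio_mem_nhds hta] with x hx
        rw [max_eq_right (by simp only [mem_Iio] at hx; linarith), Real.zero_rpow (by linarith),
          zero_smul]
      · exact absurd (hta ▸ haB) htB
      · rw [indicator_of_mem (by simpa using hta)]
        have h1 : HasDerivAt (fun x : ℝ => (x - a) ^ ((k : ℝ) + 1 - α))
            (((k : ℝ) + 1 - α) * (t - a) ^ ((k : ℝ) - α)) t := by
          have := ((hasDerivAt_id t).sub_const a).rpow_const (p := (k : ℝ) + 1 - α)
            (Or.inl (by simp only [id]; linarith))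
          simp only [id, one_mul] at this
          convert this using 2
          congr 1; ring
        refine (h1.smul_const C).congr_of_eventuallyEq ?_
        filter_upwards [Ioi_mem_nhds hta] with x hx
        rw [max_eq_left (by simp only [mem_Ioi] at hx; linarith)]
    · have h1 : IntervalIntegrable
          (fun t : ℝ => (((k : ℝ) + 1 - α) * (t - a) ^ ((k : ℝ) - α)) • C) volume 0 b := by
        have := (intervalIntegral.intervalIntegrable_rpow' (r := (k : ℝ) - α) (by linarith)
          (a := 0 - a) (b := b - a)).comp_sub_right a
        simp only [sub_add_cancel] at this
        have h2 := this.const_mul ((k : ℝ) + 1 - α)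
        exact ⟨h2.1.smul_const C, h2.2.smul_const C⟩
      exact ⟨h1.1.indicator measurableSet_Ioi, h1.2.indicator measurableSet_Ioi⟩

/-- Binomial expansion of `t ^ k` about the cut-off point reduces to the centered powers. -/
theorem FracRegular.truncPow [CompleteSpace E] (hα : α < 1) {a : ℝ} (ha : 0 ≤ a)
    (haB : a ∈ B) (k : ℕ) (c : E) :
    FracRegular α b B ((Ioi a).indicator fun t => t ^ k • c) := by
  have h := FracRegular.sum (b := b) hα (Finset.range (k + 1)) fun m _ =>
    FracRegular.truncPow_centered (b := b) hα ha haB m ((a ^ (k - m) * (k.choose m : ℝ)) • c)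
  refine h.congr fun t _ => ?_
  by_cases ht : t ∈ Ioi a
  · simp only [indicator_of_mem ht, smul_smul, ← Finset.sum_smul]
    congr 1
    conv_lhs => rw [show t = (t - a) + a by ring, add_pow]
    exact Finset.sum_congr rfl fun m _ => by ring
  · simp [indicator_of_notMem ht]

theorem FracRegular.indicator_pow [CompleteSpace E] (hα : α < 1) {a a' : ℝ} (ha : 0 ≤ a)
    (haa' : a ≤ a') (haB : a ∈ B) (haB' : a' ∈ B) (k : ℕ) (c : E) :
    FracRegular α b B ((Ioc a a').indicator fun t => t ^ k • c) := by
  refine ((FracRegular.truncPow hα ha haB k c).add hα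
    ((FracRegular.truncPow hα (ha.trans haa') haB' k c).const_smul (-1))).congr fun t _ => ?_
  by_cases h1 : a < t <;> by_cases h2 : t ≤ a'
  · simp [indicator, h1, h2, not_lt.2 h2]
  · simp [indicator, h1, h2, not_le.1 h2]
  · simp [indicator, h1, h2, not_lt.2 h2]
  · exact absurd (haa'.trans_lt (not_le.1 h2)) h1

end Regular

/-! ## An extremum principle for the Riemann-Liouville derivative -/

theorem integral_omega_sub {α : ℝ} (hα : α < 1) (x t : ℝ) :
    ∫ s in x..t, omega (1 - α) (t - s) = (t - x) ^ (1 - α) / ((1 - α) * Real.Gamma (1 - α)) := by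
  rw [intervalIntegral.integral_comp_sub_left (fun s => omega (1 - α) s) t, sub_self,
    integral_omega hα]

theorem hasDerivAt_fracInt_const {α : ℝ} (hα : α < 1) {t : ℝ} (ht : 0 < t) (c : ℝ) :
    HasDerivAt (fracInt α fun _ => c) (omega (1 - α) t * c) t := by
  have h : fracInt α (fun _ => c) =
      fun x => x ^ (1 - α) / ((1 - α) * Real.Gamma (1 - α)) * c := by
    ext x
    have := integral_omega_sub hα 0 x
    rw [sub_zero] at this
    rw [← this, fracInt, ← intervalIntegral.integral_mul_const]
    rfl
  rw [h]
  have hG := Real.Gamma_pos_of_pos (show 0 < 1 - α by linarith)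
  have h2 := (((Real.hasDerivAt_rpow_const (p := 1 - α) (Or.inl ht.ne')).div_const
    ((1 - α) * Real.Gamma (1 - α))).mul_const c)
  rw [show 1 - α - 1 = -α by ring, mul_div_mul_left _ _ (by linarith : (1 - α) ≠ 0),
    ← omega_eq] at h2
  exact h2

/-- For `x < t`, the increment of the fractional integral from `x` to `t` splits at `x`. The part
over `(0, x)` is nonpositive because the kernel decreases and `u ≥ 0`. On `(x, t)`,
differentiability and `u t = 0` give `u s = O(t - s)`, so that part is `O((t - x)^(2 - α))`. Left
difference quotients are thus at most a multiple of `(t - x)^(1 - α)`, which tends to zero. -/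
theorem deriv_fracInt_nonpos_of_min {α : ℝ} (hα0 : 0 < α) (hα : α < 1) {u : ℝ → ℝ} {t D : ℝ}
    (ht : 0 < t) (hu : ∀ s ∈ Ioc 0 t, 0 ≤ u s) (hut : u t = 0) (hd : DifferentiableAt ℝ u t)
    (hb : ∃ M, ∀ s ∈ Ioc 0 t, ‖u s‖ ≤ M)
    (hm : AEStronglyMeasurable u (volume.restrict (Ioc 0 t)))
    (hD : HasDerivAt (fracInt α u) D t) : D ≤ 0 := by
  obtain ⟨C, hC0, hC⟩ := hd.isBigO_sub.exists_pos
  rw [Asymptotics.IsBigOWith, Metric.eventually_nhds_iff] at hC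
  obtain ⟨δ, hδ, hC⟩ := hC
  have hG := Real.Gamma_pos_of_pos (show 0 < 1 - α by linarith)
  set K := C / ((1 - α) * Real.Gamma (1 - α)) with hK
  have key : ∀ x, 0 < x → t - δ < x → x < t →
      slope (fracInt α u) t x ≤ K * (t - x) ^ (1 - α) := by
    intro x hx0 hxδ hxt
    have hi1 := intervalIntegrable_omega_smul hα hb hm t (right_mem_Icc.2 ht.le)
    have hi2 := intervalIntegrable_omega_smul hα hb hm t (⟨hx0.le, hxt.le⟩ : x ∈ Icc 0 t)
    have hi3 := intervalIntegrable_omega_smul hα hb hm x (⟨hx0.le, hxt.le⟩ : x ∈ Icc 0 t)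
    have hi4 := hi2.symm.trans hi1
    have e1 : fracInt α u t = (∫ s in (0 : ℝ)..x, omega (1 - α) (t - s) • u s) +
        ∫ s in x..t, omega (1 - α) (t - s) • u s :=
      (intervalIntegral.integral_add_adjacent_intervals hi2 hi4).symm
    have e2 : (∫ s in (0 : ℝ)..x, omega (1 - α) (t - s) • u s) ≤ fracInt α u x := by
      refine intervalIntegral.integral_mono_on_of_le_Ioo hx0.le hi2 hi3 fun s hs => ?_
      exact mul_le_mul_of_nonneg_right (omega_anti hα0 hα (by linarith [hs.2]) (by linarith))
        (hu s ⟨hs.1, by linarith [hs.2]⟩)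
    have e3 : (∫ s in x..t, omega (1 - α) (t - s) • u s) ≤
        ∫ s in x..t, omega (1 - α) (t - s) * (C * (t - x)) := by
      refine intervalIntegral.integral_mono_on_of_le_Ioo hxt.le hi4
        ((intervalIntegrable_omega_sub hα t x t).mul_const _) fun s hs => ?_
      refine mul_le_mul_of_nonneg_left ?_ (omega_nonneg hα (by linarith [hs.2]))
      have := @hC s (by rw [Real.dist_eq, abs_lt]; constructor <;> linarith [hs.1, hs.2])
      rw [hut, sub_zero, Real.norm_eq_abs, Real.norm_eq_abs, abs_sub_comm,
        abs_of_nonneg (by linarith [hs.2] : 0 ≤ t - s)] at this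
      exact (le_abs_self _).trans (this.trans
        (mul_le_mul_of_nonneg_left (by linarith [hs.1]) hC0.le))
    rw [intervalIntegral.integral_mul_const, integral_omega_sub hα] at e3
    rw [slope_comm, slope_def_field, div_le_iff₀ (by linarith)]
    have : (t - x) ^ (1 - α) / ((1 - α) * Real.Gamma (1 - α)) * (C * (t - x)) =
        K * (t - x) ^ (1 - α) * (t - x) := by rw [hK]; ring
    linarith
  have h1 : Tendsto (slope (fracInt α u) t) (𝓝[<] t) (𝓝 D) :=
    hD.tendsto_slope.mono_left (nhdsWithin_mono _ fun x hx => ne_of_lt hx)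
  have h2 : Tendsto (fun x : ℝ => K * (t - x) ^ (1 - α)) (𝓝[<] t) (𝓝 0) := by
    have hc : Continuous fun x : ℝ => K * (t - x) ^ (1 - α) :=
      continuous_const.mul ((continuous_const.sub continuous_id).rpow_const
        fun x => Or.inr (by linarith))
    have := hc.tendsto t
    simp only [sub_self] at this
    rw [Real.zero_rpow (by linarith), mul_zero] at this
    exact this.mono_left nhdsWithin_le_nhds
  refine le_of_tendsto_of_tendsto h1 h2 ?_
  filter_upwards [Ioo_mem_nhdsLT (max_lt ht (by linarith : t - δ < t))] with x hx
  exact key x ((le_max_left _ _).trans_lt hx.1) ((le_max_right _ _).trans_lt hx.1) hx.2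

/-! ## Piecewise polynomials -/

/-- `v` is a polynomial of degree at most `p` on each of the first `n` cells of the mesh `b`. -/
def PiecewisePoly {S : Type*} [AddCommGroup S] [Module ℝ S] (p : ℕ) (b : ℕ → ℝ) (n : ℕ)
    (v : ℝ → S) : Prop :=
  ∀ m < n, IsPolyOn p (Ioc (b m) (b (m + 1))) v

section Poly

variable {S : Type*} [AddCommGroup S] [Module ℝ S] {p n : ℕ} {b : ℕ → ℝ} {I : Set ℝ}

theorem IsPolyOn.sub {v w : ℝ → S} (hv : IsPolyOn p I v) (hw : IsPolyOn p I w) :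
    IsPolyOn p I (fun t => v t - w t) := by
  obtain ⟨a, ha⟩ := hv
  obtain ⟨c, hc⟩ := hw
  exact ⟨fun i => a i - c i, fun t ht => by
    simp only [ha t ht, hc t ht, smul_sub, Finset.sum_sub_distrib]⟩

theorem IsPolyOn.congr {v w : ℝ → S} (hv : IsPolyOn p I v) (h : ∀ t ∈ I, w t = v t) :
    IsPolyOn p I w := by
  obtain ⟨a, ha⟩ := hv
  exact ⟨a, fun t ht => (h t ht).trans (ha t ht)⟩

theorem isPolyOn_const (c : S) : IsPolyOn p I (fun _ => c) :=
  ⟨fun i => if i = 0 then c else 0, fun t _ => by simp [Finset.sum_ite_eq']⟩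

theorem IsPolyOn.map {S' : Type*} [AddCommGroup S'] [Module ℝ S'] (L : S →ₗ[ℝ] S') {v : ℝ → S}
    (hv : IsPolyOn p I v) : IsPolyOn p I (fun t => L (v t)) := by
  obtain ⟨a, ha⟩ := hv
  exact ⟨fun i => L (a i), fun t ht => by simp [ha t ht]⟩

theorem IsPolyOn.inner {H : Type*} [NormedAddCommGroup H] [InnerProductSpace ℝ H] {v w : ℝ → H}
    (hv : IsPolyOn p I v) (hw : IsPolyOn p I w) :
    IsPolyOn (p + p) I (fun t => inner ℝ (v t) (w t)) := by
  obtain ⟨a, ha⟩ := hv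
  obtain ⟨c, hc⟩ := hw
  refine ⟨fun k => ∑ i ∈ Finset.range (p + 1), ∑ j ∈ Finset.range (p + 1),
    if i + j = k then Inner.inner ℝ (a j) (c i) else 0, fun t ht => ?_⟩
  simp only [ha t ht, hc t ht, inner_sum, sum_inner, Finset.smul_sum]
  rw [Finset.sum_comm (s := Finset.range (p + p + 1))]
  refine Finset.sum_congr rfl fun i hi => ?_
  rw [Finset.sum_comm (s := Finset.range (p + p + 1))]
  refine Finset.sum_congr rfl fun j hj => ?_
  have : i + j ∈ Finset.range (p + p + 1) := by
    simp only [Finset.mem_range] at hi hj ⊢; omega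
  simp only [smul_ite, smul_zero]
  rw [Finset.sum_ite_eq, if_pos this]
  simp only [inner_smul_left, inner_smul_right, smul_eq_mul, RCLike.conj_to_real]
  ring

/-- Doubling the degree keeps squared norms in the class, so their fractional integrals are regular
as well. -/
theorem PiecewisePoly.normSq {H : Type*} [NormedAddCommGroup H] [InnerProductSpace ℝ H] {v : ℝ → H}
    (hv : PiecewisePoly p b n v) :
    PiecewisePoly (p + p) b n fun s => ‖v s‖ ^ 2 := fun m hm => by
  simpa only [real_inner_self_eq_norm_sq] using (hv m hm).inner (hv m hm)

theorem PiecewisePoly.mono {v : ℝ → S} (hv : PiecewisePoly p b n v) {m : ℕ} (hm : m ≤ n) :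
    PiecewisePoly p b m v := fun k hk => hv k (hk.trans_le hm)

theorem exists_mem_cell (hb0 : b 0 = 0) (hb : Monotone b) {t : ℝ} (ht : t ∈ Ioc 0 (b n)) :
    ∃ m < n, t ∈ Ioc (b m) (b (m + 1)) := by
  have := hb.biUnion_Ico_Ioc_map_succ 0 n
  rw [hb0] at this
  rw [← this] at ht
  simp only [mem_iUnion] at ht
  obtain ⟨m, hm, h⟩ := ht
  exact ⟨m, hm.2, h⟩

theorem PiecewisePoly.indicator_Ioi {v : ℝ → S} (hv : PiecewisePoly p b n v) (hb : Monotone b)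
    (k : ℕ) : PiecewisePoly p b n ((Ioi (b k)).indicator v) := by
  intro m hm
  rcases le_or_gt k m with h | h
  · refine (hv m hm).congr fun t ht => indicator_of_mem ?_ _
    exact (hb h).trans_lt ht.1
  · refine (isPolyOn_const 0).congr fun t ht => indicator_of_notMem ?_ _
    simpa using ht.2.trans (hb h)

theorem PiecewisePoly.indicator_Iic {v : ℝ → S} (hv : PiecewisePoly p b n v) (hb : Monotone b)
    (k : ℕ) : PiecewisePoly p b n ((Iic (b k)).indicator v) := by
  intro m hm
  rcases le_or_gt k m with h | h
  · refine (isPolyOn_const 0).congr fun t ht => indicator_of_notMem ?_ _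
    simpa using (hb h).trans_lt ht.1
  · refine (hv m hm).congr fun t ht => indicator_of_mem ?_ _
    exact ht.2.trans (hb h)

/-- A piecewise polynomial is a finite sum of monomials cut off to the cells, and each of these is a
difference of two truncated powers. -/
theorem PiecewisePoly.fracRegular {E : Type*} [NormedAddCommGroup E] [NormedSpace ℝ E]
    [CompleteSpace E] {α : ℝ} (hα : α < 1) (hb0 : b 0 = 0) (hb : Monotone b) {v : ℝ → E}
    (hv : PiecewisePoly p b n v) : FracRegular α (b n) (range b) v := by
  choose! a ha using hv
  have hpos : ∀ m, 0 ≤ b m := fun m => hb0 ▸ hb (Nat.zero_le m)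
  have h := FracRegular.sum (b := b n) (B := range b) hα (Finset.range n) fun m _ =>
    FracRegular.sum (b := b n) hα (Finset.range (p + 1)) fun i _ =>
      FracRegular.indicator_pow (b := b n) hα (hpos m) (hb m.le_succ) (mem_range_self m)
        (mem_range_self (m + 1)) i (a m i)
  refine h.congr fun t ht => ?_
  obtain ⟨m, hm, htm⟩ := exists_mem_cell hb0 hb ht
  rw [Finset.sum_eq_single_of_mem m (Finset.mem_range.2 hm)]
  · rw [ha m hm t htm]
    exact Finset.sum_congr rfl fun i _ =>
      (indicator_of_mem (s := Ioc (b m) (b (m + 1))) htm fun t => t ^ i • a m i).symm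
  · intro k _ hkm
    refine Finset.sum_eq_zero fun i _ => indicator_of_notMem (fun hk => ?_) _
    exact (disjoint_left.1 (hb.pairwise_disjoint_on_Ioc_succ hkm)) hk htm

theorem PiecewisePoly.differentiableAt {E : Type*} [NormedAddCommGroup E] [NormedSpace ℝ E]
    (hb0 : b 0 = 0) (hb : Monotone b) {v : ℝ → E}
    (hv : PiecewisePoly p b n v) {t : ℝ} (ht : t ∈ Ioo 0 (b n)) (htb : t ∉ range b) :
    DifferentiableAt ℝ v t := by
  obtain ⟨m, hm, htm⟩ := exists_mem_cell hb0 hb ⟨ht.1, ht.2.le⟩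
  obtain ⟨a, ha⟩ := hv m hm
  have h1 : t ≠ b (m + 1) := fun h => htb ⟨_, h.symm⟩
  have h2 : DifferentiableAt ℝ (fun t : ℝ => ∑ i ∈ Finset.range (p + 1), t ^ i • a i) t := by
    fun_prop
  refine h2.congr_of_eventuallyEq ?_
  filter_upwards [Ioo_mem_nhds htm.1 (lt_of_le_of_ne htm.2 h1)] with s hs
  exact ha s (Ioo_subset_Ioc_self hs)

end Poly

/-! ## Coercivity of the Riemann-Liouville derivative -/

section Coercive

theorem ae_mem_Ioo_not_mem {b : ℕ → ℝ} {x y : ℝ} :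
    ∀ᵐ t ∂(volume.restrict (Ioc x y)), t ∈ Ioo x y ∧ t ∉ range b := by
  have h1 : ∀ᵐ t : ℝ, t ∉ range b ∪ {y} :=
    ((countable_range b).union (countable_singleton y)).ae_notMem volume
  filter_upwards [ae_restrict_mem measurableSet_Ioc, ae_restrict_of_ae h1] with t h1 h2
  simp only [mem_union, mem_singleton_iff, not_or] at h2
  exact ⟨⟨h1.1, lt_of_le_of_ne h1.2 h2.2⟩, h2.1⟩

theorem FracRegular.integrableOn_rlDeriv {E : Type*} [NormedAddCommGroup E] [NormedSpace ℝ E]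
    {α x : ℝ} {b : ℕ → ℝ} {v : ℝ → E} (hv : FracRegular α x (range b) v) :
    IntegrableOn (rlDeriv α 0 v) (Ioc 0 x) := by
  obtain ⟨g, hg, hi⟩ := hv.deriv
  refine hi.1.congr ?_
  filter_upwards [ae_mem_Ioo_not_mem (b := b)] with t ht
  exact (hg t ht.1 ht.2).deriv.symm

theorem FracRegular.hasDerivAt {E : Type*} [NormedAddCommGroup E] [NormedSpace ℝ E]
    {α x : ℝ} {B : Set ℝ} {v : ℝ → E} (hv : FracRegular α x B v) {t : ℝ} (ht : t ∈ Ioo 0 x)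
    (htB : t ∉ B) : HasDerivAt (fracInt α v) (rlDeriv α 0 v t) t := by
  obtain ⟨g, hg, -⟩ := hv.deriv
  exact (hg t ht htB).differentiableAt.hasDerivAt

/-- The fundamental theorem of calculus tolerates the countable set of mesh points because the
fractional integral is continuous across them; it vanishes at zero. -/
theorem FracRegular.integral_rlDeriv {E : Type*} [NormedAddCommGroup E] [NormedSpace ℝ E]
    [CompleteSpace E] {α x : ℝ} {b : ℕ → ℝ} {v : ℝ → E} (hx : 0 ≤ x)
    (hv : FracRegular α x (range b) v) :
    ∫ t in (0 : ℝ)..x, rlDeriv α 0 v t = fracInt α v x := by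
  rw [integral_eq_of_hasDerivAt_off_countable_of_le (fracInt α v) (rlDeriv α 0 v) hx
    (countable_range b) hv.cont (fun t ht => hv.hasDerivAt ht.1 ht.2)
    ((intervalIntegrable_iff_integrableOn_Ioc_of_le hx).2 hv.integrableOn_rlDeriv)]
  simp [fracInt]

variable {H : Type*} [NormedAddCommGroup H] [InnerProductSpace ℝ H]

theorem integrableOn_inner_of_bdd {g v : ℝ → H} {S : Set ℝ} (hS : MeasurableSet S)
    (hg : IntegrableOn g S) (hb : ∃ M, ∀ t ∈ S, ‖v t‖ ≤ M)
    (hm : AEStronglyMeasurable v (volume.restrict S)) :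
    IntegrableOn (fun s => inner ℝ (g s) (v s)) S := by
  obtain ⟨M, hM⟩ := hb
  refine Integrable.mono' (hg.norm.mul_const M) (hg.aestronglyMeasurable.inner hm) ?_
  filter_upwards [ae_restrict_mem hS] with t ht
  exact (norm_inner_le_norm _ _).trans (mul_le_mul_of_nonneg_left (hM t ht) (norm_nonneg _))

theorem PiecewisePoly.integrableOn_omega_normSq {α : ℝ} {p n : ℕ} {b : ℕ → ℝ} {v : ℝ → H} (hα : α < 1) (hb0 : b 0 = 0)
    (hb : Monotone b) (hv : PiecewisePoly p b n v) :
    IntegrableOn (fun t => omega (1 - α) t * ‖v t‖ ^ 2) (Ioc 0 (b n)) := by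
  have r := hv.normSq.fracRegular hα hb0 hb
  exact integrableOn_smul_of_bdd measurableSet_Ioc (intervalIntegrable_omega hα 0 (b n)).1
    r.bdd r.meas

variable [CompleteSpace H] {α : ℝ} {p n : ℕ} {b : ℕ → ℝ} {v : ℝ → H}

/-- The pointwise inequality
`½ ω_{1-α}(t) ‖v(t)‖² + ½ ∂^α ‖v‖² (t) ≤ ⟨∂^α v(t), v(t)⟩`. -/
theorem PiecewisePoly.inner_rlDeriv_ge (hα0 : 0 < α) (hα : α < 1) (hb0 : b 0 = 0)
    (hb : Monotone b) (hv : PiecewisePoly p b n v) {t : ℝ} (ht : t ∈ Ioo 0 (b n))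
    (htb : t ∉ range b) :
    omega (1 - α) t * ‖v t‖ ^ 2 + rlDeriv α 0 (fun s => ‖v s‖ ^ 2) t ≤
      2 * inner ℝ (rlDeriv α 0 v t) (v t) := by
  set c := v t with hc
  -- The extremum principle is applied to `s ↦ ‖v s - v t‖²`, with `c = v t` frozen. Expanding the
  -- square turns the sign of its derivative at `t` into the claim.
  have hu : PiecewisePoly (p + p) b n fun s => ‖v s - c‖ ^ 2 :=
    PiecewisePoly.normSq (v := fun s => v s - c) fun m hm => (hv m hm).sub (isPolyOn_const c)
  have rv := hv.fracRegular hα hb0 hb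
  have rn := hv.normSq.fracRegular hα hb0 hb
  have ru := hu.fracRegular hα hb0 hb
  have hfun : fracInt α (fun s => ‖v s - c‖ ^ 2) =ᶠ[𝓝 t] fun x =>
      fracInt α (fun s => ‖v s‖ ^ 2) x - 2 * inner ℝ c (fracInt α v x) +
        fracInt α (fun _ => ‖c‖ ^ 2) x := by
    filter_upwards [Ioo_mem_nhds ht.1 ht.2] with x hx
    have hxI := Ioo_subset_Icc_self hx
    have i1 := intervalIntegrable_omega_smul hα rv.bdd rv.meas x hxI
    have i2 := intervalIntegrable_omega_smul hα rn.bdd rn.meas x hxI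
    have i3 := (intervalIntegrable_omega_sub hα x 0 x).mul_const (‖c‖ ^ 2)
    have e1 : inner ℝ c (fracInt α v x) =
        ∫ s in (0 : ℝ)..x, inner ℝ c (omega (1 - α) (x - s) • v s) :=
      ((innerSL ℝ c).intervalIntegral_comp_comm i1).symm
    have i4 : IntervalIntegrable (fun s => inner ℝ c (omega (1 - α) (x - s) • v s)) volume 0 x :=
      ⟨i1.1.const_inner c, i1.2.const_inner c⟩
    rw [e1, ← intervalIntegral.integral_const_mul]
    simp only [fracInt, smul_eq_mul (a := omega _ _) (b := ‖c‖ ^ 2)]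
    rw [← intervalIntegral.integral_sub i2 (i4.const_mul 2),
      ← intervalIntegral.integral_add (i2.sub (i4.const_mul 2)) i3]
    refine intervalIntegral.integral_congr fun s _ => ?_
    simp only [smul_eq_mul, inner_smul_right]
    rw [norm_sub_sq_real, real_inner_comm]
    ring
  have hD := ((((rn.hasDerivAt ht htb).sub
    (((innerSL ℝ c).hasFDerivAt.comp_hasDerivAt t (rv.hasDerivAt ht htb)).const_mul 2)).add
      (hasDerivAt_fracInt_const hα ht.1 (‖c‖ ^ 2)))).congr_of_eventuallyEq
        (f₁ := fracInt α (fun s => ‖v s - c‖ ^ 2)) hfun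
  have hsub : Ioc 0 t ⊆ Ioc 0 (b n) := Ioc_subset_Ioc_right ht.2.le
  have := deriv_fracInt_nonpos_of_min hα0 hα ht.1 (fun s _ => by positivity) (by simp [hc])
    (hu.differentiableAt hb0 hb ht htb)
    (by obtain ⟨M, hM⟩ := ru.bdd; exact ⟨M, fun s hs => hM s (hsub hs)⟩)
    (ru.meas.mono_set hsub) hD
  simp only [innerSL_apply_apply] at this
  rw [real_inner_comm]
  linarith

theorem PiecewisePoly.integrableOn_inner_rlDeriv {q : ℕ} {w : ℝ → H} (hα : α < 1) (hb0 : b 0 = 0)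
    (hb : Monotone b) (hv : PiecewisePoly p b n v) (hw : PiecewisePoly q b n w) :
    IntegrableOn (fun t => inner ℝ (rlDeriv α 0 v t) (w t)) (Ioc 0 (b n)) :=
  integrableOn_inner_of_bdd measurableSet_Ioc (hv.fracRegular hα hb0 hb).integrableOn_rlDeriv
    (hw.fracRegular hα hb0 hb).bdd (hw.fracRegular hα hb0 hb).meas

theorem PiecewisePoly.integral_inner_rlDeriv_ge (hα0 : 0 < α) (hα : α < 1) (hb0 : b 0 = 0)
    (hb : Monotone b) (hv : PiecewisePoly p b n v) :
    (∫ t in (0 : ℝ)..b n, omega (1 - α) t * ‖v t‖ ^ 2) ≤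
      2 * ∫ t in (0 : ℝ)..b n, inner ℝ (rlDeriv α 0 v t) (v t) := by
  have hn : 0 ≤ b n := hb0 ▸ hb (Nat.zero_le n)
  have rn := hv.normSq.fracRegular hα hb0 hb
  -- This integral is the fractional integral of a nonnegative function at the endpoint, so it can
  -- be dropped.
  have h1 : 0 ≤ ∫ t in (0 : ℝ)..b n, rlDeriv α 0 (fun s => ‖v s‖ ^ 2) t := by
    rw [rn.integral_rlDeriv hn]
    exact intervalIntegral.integral_nonneg hn fun s hs =>
      mul_nonneg (omega_nonneg hα (by linarith [hs.2])) (by positivity)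
  have hi1 := hv.integrableOn_omega_normSq hα hb0 hb
  have hi2 := rn.integrableOn_rlDeriv
  have hi3 := hv.integrableOn_inner_rlDeriv hα hb0 hb hv
  rw [intervalIntegral.integral_of_le hn] at h1
  rw [intervalIntegral.integral_of_le hn, intervalIntegral.integral_of_le hn,
    ← integral_const_mul]
  have h2 : (∫ t in Ioc 0 (b n), omega (1 - α) t * ‖v t‖ ^ 2 + rlDeriv α 0 (fun s => ‖v s‖ ^ 2) t) ≤
      ∫ t in Ioc 0 (b n), 2 * inner ℝ (rlDeriv α 0 v t) (v t) := by
    refine integral_mono_ae (hi1.add hi2) (hi3.const_mul 2) ?_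
    filter_upwards [ae_mem_Ioo_not_mem (b := b)] with t ht
    exact hv.inner_rlDeriv_ge hα0 hα hb0 hb ht.1 ht.2
  rw [integral_add hi1 hi2] at h2
  linarith

end Coercive

/-! ## The kernel `ω_{-α}` and the splitting of the memory term -/

/-- From `Γ(1 - α) = -α Γ(-α)`; the kernel `ω_{-α}` is negative on positive times. -/
theorem omega_neg_eq {α : ℝ} (hα0 : 0 < α) (t : ℝ) :
    omega (-α) t = -(α / Real.Gamma (1 - α) * t ^ (-α - 1)) := by
  have h := Real.Gamma_add_one (neg_ne_zero.2 hα0.ne')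
  rw [show -α + 1 = 1 - α by ring] at h
  rw [omega, h, neg_mul, div_neg, neg_mul, neg_neg, ← div_div, div_self hα0.ne']
  ring

theorem abs_omega_neg {α : ℝ} (hα0 : 0 < α) (hα : α < 1) {t : ℝ} (ht : 0 ≤ t) :
    |omega (-α) t| = α / Real.Gamma (1 - α) * t ^ (-α - 1) := by
  have hG := Real.Gamma_pos_of_pos (show 0 < 1 - α by linarith)
  rw [omega_neg_eq hα0, abs_neg, abs_of_nonneg]
  exact mul_nonneg (by positivity) (Real.rpow_nonneg ht _)

theorem hasDerivAt_omega {α : ℝ} (hα0 : 0 < α) {t : ℝ} (ht : 0 < t) :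
    HasDerivAt (omega (1 - α)) (omega (-α) t) t := by
  have h : omega (1 - α) = fun t => t ^ (-α) / Real.Gamma (1 - α) := by
    ext t; exact omega_eq α t
  rw [h, omega_neg_eq hα0]
  have := (Real.hasDerivAt_rpow_const (p := -α) (Or.inl ht.ne')).div_const (Real.Gamma (1 - α))
  rwa [show -α * t ^ (-α - 1) / Real.Gamma (1 - α) = -(α / Real.Gamma (1 - α) * t ^ (-α - 1)) by
    ring] at this

theorem hasDerivAt_history {E : Type*} [NormedAddCommGroup E] [NormedSpace ℝ E] {α a t : ℝ}
    (hα0 : 0 < α) (hα : α < 1) (ha : 0 ≤ a) (hat : a < t) {v : ℝ → E}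
    (hb : ∃ M, ∀ s ∈ Ioc 0 a, ‖v s‖ ≤ M)
    (hm : AEStronglyMeasurable v (volume.restrict (Ioc 0 a))) :
    HasDerivAt (fun x => ∫ s in (0 : ℝ)..a, omega (1 - α) (x - s) • v s)
      (∫ s in (0 : ℝ)..a, omega (-α) (t - s) • v s) t := by
  obtain ⟨M, hM⟩ := id hb
  have hmeas : ∀ β x : ℝ, Measurable fun s : ℝ => omega β (x - s) := fun β x => by
    unfold omega; fun_prop
  -- For `x > a + c` every lag `x - s` with `s ≤ a` exceeds `c`, away from the singularity, so
  -- `|ω_{-α}(c)| M` dominates the differentiated integrand.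
  set c := (t - a) / 2 with hc
  have hc0 : 0 < c := by rw [hc]; linarith
  refine (intervalIntegral.hasDerivAt_integral_of_dominated_loc_of_deriv_le
    (F := fun x s => omega (1 - α) (x - s) • v s) (F' := fun x s => omega (-α) (x - s) • v s)
    (bound := fun _ => |omega (-α) c| * M)
    (s := Ioi (a + c)) (Ioi_mem_nhds (by rw [hc]; linarith)) ?_ ?_ ?_ ?_ ?_ ?_).2
  · rw [uIoc_of_le ha]
    exact Eventually.of_forall fun x => (hmeas _ x).aestronglyMeasurable.smul hm
  · exact intervalIntegrable_omega_smul hα hb hm t (right_mem_Icc.2 ha)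
  · rw [uIoc_of_le ha]
    exact (hmeas _ t).aestronglyMeasurable.smul hm
  · refine ae_of_all _ fun s hs x hx => ?_
    rw [uIoc_of_le ha] at hs
    rw [norm_smul, Real.norm_eq_abs]
    have h1 : c ≤ x - s := by have := hs.2; simp only [mem_Ioi] at hx; linarith
    refine mul_le_mul ?_ (hM s hs) (norm_nonneg _) (abs_nonneg _)
    rw [abs_omega_neg hα0 hα (hc0.le.trans h1), abs_omega_neg hα0 hα hc0.le]
    have hG := Real.Gamma_pos_of_pos (show 0 < 1 - α by linarith)
    exact mul_le_mul_of_nonneg_left (Real.rpow_le_rpow_of_nonpos hc0 h1 (by linarith))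
      (by positivity)
  · exact intervalIntegrable_const
  · refine ae_of_all _ fun s hs x hx => ?_
    rw [uIoc_of_le ha] at hs
    have h1 : 0 < x - s := by have := hs.2; simp only [mem_Ioi] at hx; linarith
    have h2 := (hasDerivAt_omega hα0 h1).comp x ((hasDerivAt_id x).sub_const s)
    rw [mul_one] at h2
    exact h2.smul_const (v s)

section Split

variable {E : Type*} [NormedAddCommGroup E] [NormedSpace ℝ E] {α : ℝ} {p n : ℕ} {b : ℕ → ℝ}
  {v : ℝ → E}

theorem fracInt_indicator_Ioi {a x : ℝ} (ha : 0 ≤ a) (hx : a ≤ x) :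
    fracInt α ((Ioi a).indicator v) x = ∫ s in a..x, omega (1 - α) (x - s) • v s := by
  have : Ioc 0 x ∩ Ioi a = Ioc a x := by
    ext s; simp only [mem_inter_iff, mem_Ioc, mem_Ioi]
    exact ⟨fun h => ⟨h.2, h.1.2⟩, fun h => ⟨⟨ha.trans_lt h.1, h.2⟩, h.1⟩⟩
  rw [fracInt, intervalIntegral.integral_of_le (ha.trans hx), intervalIntegral.integral_of_le hx,
    ← this, ← setIntegral_indicator measurableSet_Ioi]
  refine integral_congr_ae (ae_of_all _ fun s => ?_)
  by_cases hs : s ∈ Ioi a <;> simp [hs, indicator]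

theorem fracInt_indicator_Iic {a x : ℝ} (ha : 0 ≤ a) (hx : a ≤ x) :
    fracInt α ((Iic a).indicator v) x = ∫ s in (0 : ℝ)..a, omega (1 - α) (x - s) • v s := by
  have : Ioc 0 x ∩ Iic a = Ioc 0 a := by
    ext s; simp only [mem_inter_iff, mem_Ioc, mem_Iic]
    exact ⟨fun h => ⟨h.1.1, h.2⟩, fun h => ⟨⟨h.1, h.2.trans hx⟩, h.2⟩⟩
  rw [fracInt, intervalIntegral.integral_of_le (ha.trans hx), intervalIntegral.integral_of_le ha,
    ← this, ← setIntegral_indicator measurableSet_Iic]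
  refine integral_congr_ae (ae_of_all _ fun s => ?_)
  by_cases hs : s ∈ Iic a <;> simp [hs, indicator]

/-- Moving the base point to `a` amounts to erasing the function up to `a`; regularity results for
base point zero then cover the local part of the scheme. -/
theorem rlDeriv_eq_indicator {a t : ℝ} (ha : 0 ≤ a) (ht : a < t) :
    rlDeriv α a v t = rlDeriv α 0 ((Ioi a).indicator v) t := by
  rw [rlDeriv_zero, rlDeriv]
  refine Filter.EventuallyEq.deriv_eq ?_
  filter_upwards [Ioi_mem_nhds ht] with x hx
  exact (fracInt_indicator_Ioi ha (le_of_lt hx)).symm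

/-- Past `b k` the old part of the integral has no singularity, so it is differentiated under the
integral sign, where `ω_{1-α}' = ω_{-α}`. -/
theorem PiecewisePoly.rlDeriv_split [CompleteSpace E] (hα0 : 0 < α) (hα : α < 1) (hb0 : b 0 = 0)
    (hb : Monotone b) (hv : PiecewisePoly p b n v) {t : ℝ} (ht : t ∈ Ioo 0 (b n))
    (htb : t ∉ range b) {k : ℕ} (hk : b k < t) :
    rlDeriv α 0 v t =
      rlDeriv α (b k) v t + ∫ s in (0 : ℝ)..b k, omega (-α) (t - s) • v s := by
  have hpos : 0 ≤ b k := hb0 ▸ hb (Nat.zero_le k)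
  have r := hv.fracRegular hα hb0 hb
  have r1 := (hv.indicator_Ioi hb k).fracRegular hα hb0 hb
  have r2 := (hv.indicator_Iic hb k).fracRegular hα hb0 hb
  have hsub : Ioc 0 (b k) ⊆ Ioc 0 (b n) := Ioc_subset_Ioc_right (hk.le.trans ht.2.le)
  have hH := hasDerivAt_history hα0 hα hpos hk (v := v)
    (by obtain ⟨M, hM⟩ := r.bdd; exact ⟨M, fun s hs => hM s (hsub hs)⟩) (r.meas.mono_set hsub)
  rw [rlDeriv_eq_indicator hpos hk, rlDeriv_zero]
  refine HasDerivAt.deriv (((r1.hasDerivAt ht htb).add hH).congr_of_eventuallyEq ?_)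
  filter_upwards [Ioi_mem_nhds hk, Ioo_mem_nhds ht.1 ht.2] with x hx hx'
  rw [Pi.add_apply, ← fracInt_indicator_Iic hpos (le_of_lt hx),
    ← fracInt_add hα r1 r2 (Ioo_subset_Icc_self hx')]
  congr 1
  ext s
  by_cases hs : s ≤ b k
  · simp [indicator, hs, not_lt.2 hs]
  · simp [indicator, hs, not_le.1 hs]

theorem PiecewisePoly.integrableOn_local [CompleteSpace E] (hα : α < 1) (hb0 : b 0 = 0)
    (hb : Monotone b) (hv : PiecewisePoly p b n v) {k : ℕ} :
    IntegrableOn (rlDeriv α (b k) v) (Ioc (b k) (b n)) := by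
  have hpos : 0 ≤ b k := hb0 ▸ hb (Nat.zero_le k)
  have r1 := ((hv.indicator_Ioi hb k).fracRegular hα hb0 hb).integrableOn_rlDeriv
  refine (r1.mono_set (Ioc_subset_Ioc_left hpos)).congr_fun (fun t ht => ?_) measurableSet_Ioc
  exact (rlDeriv_eq_indicator hpos ht.1).symm

end Split

/-! ## The history term of the fast scheme -/

section Fast

variable {H : Type*} [NormedAddCommGroup H] [InnerProductSpace ℝ H]

theorem intervalIntegrable_inner_history {a c d μ : ℝ} {V X : ℝ → H}
    (hX : IntervalIntegrable X volume c d) :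
    IntervalIntegrable
      (fun t => inner ℝ (∫ s in (0 : ℝ)..a, Real.exp (-μ * (t - s)) • V s) (X t)) volume c d := by
  have h1 : ∀ t, (∫ s in (0 : ℝ)..a, Real.exp (-μ * (t - s)) • V s) =
      Real.exp (-μ * t) • ∫ s in (0 : ℝ)..a, Real.exp (μ * s) • V s := fun t => by
    rw [← intervalIntegral.integral_smul]
    refine intervalIntegral.integral_congr fun s _ => ?_
    simp only [smul_smul, ← Real.exp_add]
    ring_nf
  simp only [h1, inner_smul_left, RCLike.conj_to_real]
  have : IntervalIntegrable
      (fun t => inner ℝ (∫ s in (0 : ℝ)..a, Real.exp (μ * s) • V s) (X t)) volume c d :=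
    ⟨hX.1.const_inner _, hX.2.const_inner _⟩
  exact this.continuousOn_mul (by fun_prop)

theorem integral_expSum_smul {E : Type*} [NormedAddCommGroup E] [NormedSpace ℝ E] {a : ℝ} {Q : ℕ}
    (w lam : Fin Q → ℝ) {V : ℝ → E} (hV : IntervalIntegrable V volume 0 a) (t : ℝ) :
    (∫ s in (0 : ℝ)..a, (∑ j, w j * Real.exp (-(lam j) * (t - s))) • V s) =
      ∑ j, w j • ∫ s in (0 : ℝ)..a, Real.exp (-(lam j) * (t - s)) • V s := by
  simp only [Finset.sum_smul, mul_smul]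
  rw [intervalIntegral.integral_finsetSum]
  · simp only [intervalIntegral.integral_smul]
  · intro j _
    exact (hV.continuousOn_smul (by fun_prop)).smul (w j)

variable [CompleteSpace H]

/-- The factorization `e^{-μ(t-s)} = e^{-μ(t-c)} e^{-μ(c-a)} e^{-μ(a-s)}` separates the test
function from the history. -/
theorem inner_moment_history {a c d μ : ℝ} {V X : ℝ → H} (hX : IntervalIntegrable X volume c d) :
    Real.exp (-μ * (c - a)) * inner ℝ (∫ t in c..d, Real.exp (-μ * (t - c)) • X t)
      (∫ s in (0 : ℝ)..a, Real.exp (-μ * (a - s)) • V s) =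
    ∫ t in c..d, inner ℝ (∫ s in (0 : ℝ)..a, Real.exp (-μ * (t - s)) • V s) (X t) := by
  set Y := ∫ s in (0 : ℝ)..a, Real.exp (-μ * (a - s)) • V s with hY
  have h1 : ∀ t, (∫ s in (0 : ℝ)..a, Real.exp (-μ * (t - s)) • V s) =
      (Real.exp (-μ * (c - a)) * Real.exp (-μ * (t - c))) • Y := fun t => by
    rw [hY, ← intervalIntegral.integral_smul]
    refine intervalIntegral.integral_congr fun s _ => ?_
    simp only [smul_smul, ← Real.exp_add]
    ring_nf
  have hX' : IntervalIntegrable (fun t => Real.exp (-μ * (t - c)) • X t) volume c d :=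
    hX.continuousOn_smul (by fun_prop)
  simp only [h1, inner_smul_left, RCLike.conj_to_real, mul_assoc]
  rw [intervalIntegral.integral_const_mul, real_inner_comm]
  congr 1
  have := ((innerSL ℝ Y).intervalIntegral_comp_comm hX').symm
  simp only [innerSL_apply_apply, inner_smul_right] at this
  exact this

theorem sum_moment_history {a c d : ℝ} {Q : ℕ} (w lam : Fin Q → ℝ) {V X : ℝ → H}
    (hV : IntervalIntegrable V volume 0 a) (hX : IntervalIntegrable X volume c d) :
    (∑ j, w j * Real.exp (-(lam j) * (c - a)) *
      inner ℝ (∫ t in c..d, Real.exp (-(lam j) * (t - c)) • X t)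
        (∫ s in (0 : ℝ)..a, Real.exp (-(lam j) * (a - s)) • V s)) =
    ∫ t in c..d, inner ℝ
      (∫ s in (0 : ℝ)..a, (∑ j, w j * Real.exp (-(lam j) * (t - s))) • V s) (X t) := by
  simp only [integral_expSum_smul w lam hV, sum_inner, inner_smul_left, RCLike.conj_to_real]
  rw [intervalIntegral.integral_finsetSum]
  · simp only [intervalIntegral.integral_const_mul, mul_assoc]
    exact Finset.sum_congr rfl fun j _ => by rw [inner_moment_history hX]
  · intro j _
    exact (intervalIntegrable_inner_history hX).const_mul (w j)

end Fast

/-! ## The perturbation of the kernel -/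

section Young

/-- The kernel `|ω_{-α}|`, cut off to `[δ, ∞)`. -/
noncomputable def cutKernel (α δ : ℝ) : ℝ → ℝ := (Ici δ).indicator fun t => |omega (-α) t|

theorem cutKernel_nonneg (α δ t : ℝ) : 0 ≤ cutKernel α δ t :=
  indicator_nonneg (fun _ _ => abs_nonneg _) t

/-- Dropping the endpoint `δ` matches the explicit power integral on the open half-line. -/
theorem cutKernel_ae {α δ : ℝ} (hα0 : 0 < α) (hα : α < 1) (hδ : 0 < δ) :
    cutKernel α δ =ᵐ[volume]
      (Ioi δ).indicator fun t => α / Real.Gamma (1 - α) * t ^ (-α - 1) := by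
  filter_upwards [(countable_singleton δ).ae_notMem volume] with t ht
  rcases lt_trichotomy t δ with h | h | h
  · simp [cutKernel, indicator, not_le.2 h, not_lt.2 h.le]
  · exact absurd h ht
  · simp [cutKernel, indicator, h, h.le, abs_omega_neg hα0 hα (hδ.le.trans h.le)]

theorem integrable_cutKernel {α δ : ℝ} (hα0 : 0 < α) (hα : α < 1) (hδ : 0 < δ) :
    Integrable (cutKernel α δ) := by
  refine Integrable.congr ?_ (cutKernel_ae hα0 hα hδ).symm
  have h : IntegrableOn (fun t : ℝ => t ^ (-α - 1)) (Ioi δ) :=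
    integrableOn_Ioi_rpow_of_lt (by linarith) hδ
  exact IntegrableOn.integrable_indicator (h.const_mul _) measurableSet_Ioi

theorem integral_cutKernel {α δ : ℝ} (hα0 : 0 < α) (hα : α < 1) (hδ : 0 < δ) :
    ∫ t, cutKernel α δ t = omega (1 - α) δ := by
  rw [integral_congr_ae (cutKernel_ae hα0 hα hδ), integral_indicator measurableSet_Ioi,
    integral_const_mul, integral_Ioi_rpow_of_lt (by linarith) hδ, omega_eq,
    show -α - 1 + 1 = -α by ring]
  field_simp

/-- The convolution of `φ` with the cut-off kernel. -/
noncomputable def kernelAvg (α δ : ℝ) (φ : ℝ → ℝ) (t : ℝ) : ℝ := ∫ s, φ s * cutKernel α δ (t - s)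

theorem integrable_kernelAvg {α δ : ℝ} (hα0 : 0 < α) (hα : α < 1) (hδ : 0 < δ) {φ : ℝ → ℝ}
    (hφ : Integrable φ) : Integrable (kernelAvg α δ φ) :=
  hφ.integrable_convolution (ContinuousLinearMap.mul ℝ ℝ) (integrable_cutKernel hα0 hα hδ)

theorem integral_kernelAvg {α δ : ℝ} (hα0 : 0 < α) (hα : α < 1) (hδ : 0 < δ) {φ : ℝ → ℝ}
    (hφ : Integrable φ) : ∫ t, kernelAvg α δ φ t = (∫ t, φ t) * omega (1 - α) δ := by
  rw [← integral_cutKernel hα0 hα hδ]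
  exact integral_convolution (ContinuousLinearMap.mul ℝ ℝ) hφ (integrable_cutKernel hα0 hα hδ)

theorem kernelAvg_nonneg {α δ : ℝ} {φ : ℝ → ℝ} (hφ : ∀ s, 0 ≤ φ s) (t : ℝ) :
    0 ≤ kernelAvg α δ φ t :=
  integral_nonneg fun s => mul_nonneg (hφ s) (cutKernel_nonneg _ _ _)

variable {H : Type*} [NormedAddCommGroup H] [InnerProductSpace ℝ H]

/-- Cauchy–Schwarz, the relative kernel bound and Young's inequality with weight `θ` under the
integral. The average of `‖V‖²` runs over the whole `(0, B]` rather than `(0, a]`, so that one and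
the same function bounds every cell and the cells can be summed. -/
theorem inner_history_le {α δ a B t η θ : ℝ} (hα0 : 0 < α) (hα : α < 1) (hδ : 0 < δ)
    (hθ : 0 < θ) (hη : 0 ≤ η) (haB : a ≤ B) (ha : 0 ≤ a) (hat : δ ≤ t - a) {R : ℝ → ℝ}
    (hR : ∀ s ∈ Ioc 0 a, |R (t - s)| ≤ η * |omega (-α) (t - s)|) {V : ℝ → H}
    (hb : ∃ M, ∀ s ∈ Ioc 0 B, ‖V s‖ ≤ M)
    (hm : AEStronglyMeasurable V (volume.restrict (Ioc 0 B))) (e : H) :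
    inner ℝ (∫ s in (0 : ℝ)..a, R (t - s) • V s) e ≤
      η * (θ / 2 * kernelAvg α δ ((Ioc 0 B).indicator fun s => ‖V s‖ ^ 2) t +
        omega (1 - α) δ / (2 * θ) * ‖e‖ ^ 2) := by
  obtain ⟨M, hM⟩ := hb
  set φ : ℝ → ℝ := (Ioc 0 B).indicator fun s => ‖V s‖ ^ 2 with hφ
  have hφ0 : ∀ s, 0 ≤ φ s := fun s => indicator_nonneg (fun _ _ => by positivity) s
  have hφm : AEStronglyMeasurable φ volume := by
    rw [hφ, aestronglyMeasurable_indicator_iff measurableSet_Ioc]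
    exact hm.norm.pow 2
  have hφM : ∀ s, ‖φ s‖ ≤ M ^ 2 := fun s => by
    rw [Real.norm_of_nonneg (hφ0 s), hφ]
    by_cases hs : s ∈ Ioc 0 B
    · rw [indicator_of_mem hs]
      exact pow_le_pow_left₀ (norm_nonneg _) (hM s hs) 2
    · rw [indicator_of_notMem hs]; positivity
  have hk : Integrable fun s => cutKernel α δ (t - s) :=
    (integrable_cutKernel hα0 hα hδ).comp_sub_left t
  have hik : ∫ s, cutKernel α δ (t - s) = omega (1 - α) δ := by
    rw [integral_sub_left_eq_self (cutKernel α δ) volume t, integral_cutKernel hα0 hα hδ]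
  have hkφ : Integrable fun s => φ s * cutKernel α δ (t - s) :=
    hk.bdd_mul hφm (ae_of_all _ hφM)
  set F : ℝ → ℝ := fun s => η * (θ / 2 * (φ s * cutKernel α δ (t - s)) +
    ‖e‖ ^ 2 / (2 * θ) * cutKernel α δ (t - s)) with hF
  have hFi : Integrable F := ((hkφ.const_mul _).add (hk.const_mul _)).const_mul η
  have hF0 : ∀ s, 0 ≤ F s := fun s => by
    have := hφ0 s
    have := cutKernel_nonneg α δ (t - s)
    positivity
  have hFint : ∫ s, F s = η * (θ / 2 * kernelAvg α δ φ t +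
      omega (1 - α) δ / (2 * θ) * ‖e‖ ^ 2) := by
    rw [hF, integral_const_mul, integral_add (hkφ.const_mul _) (hk.const_mul _),
      integral_const_mul, integral_const_mul, hik, kernelAvg]
    ring
  rw [← hFint]
  refine (real_inner_le_norm _ _).trans ?_
  rw [mul_comm, ← abs_of_nonneg (norm_nonneg e), ← Real.norm_eq_abs, ← norm_smul,
    intervalIntegral.integral_of_le ha, ← integral_smul]
  refine (norm_integral_le_of_norm_le hFi.integrableOn ?_).trans
    (setIntegral_le_integral hFi (ae_of_all _ hF0))
  filter_upwards [ae_restrict_mem measurableSet_Ioc] with s hs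
  have hsB : s ∈ Ioc 0 B := ⟨hs.1, hs.2.trans haB⟩
  have hts : δ ≤ t - s := by linarith [hs.2]
  have hc : cutKernel α δ (t - s) = |omega (-α) (t - s)| :=
    indicator_of_mem (by simpa using hts) _
  have hφs : φ s = ‖V s‖ ^ 2 := indicator_of_mem hsB _
  rw [norm_smul, norm_smul, norm_norm, Real.norm_eq_abs, hF]
  simp only [hc, hφs]
  have hyoung : ‖e‖ * ‖V s‖ ≤ θ / 2 * ‖V s‖ ^ 2 + ‖e‖ ^ 2 / (2 * θ) := by
    have : θ / 2 * ‖V s‖ ^ 2 + ‖e‖ ^ 2 / (2 * θ) - ‖e‖ * ‖V s‖ =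
        (θ * ‖V s‖ - ‖e‖) ^ 2 / (2 * θ) := by field_simp; ring
    have : 0 ≤ (θ * ‖V s‖ - ‖e‖) ^ 2 / (2 * θ) := by positivity
    linarith
  calc ‖e‖ * (|R (t - s)| * ‖V s‖) = |R (t - s)| * (‖e‖ * ‖V s‖) := by ring
    _ ≤ (η * |omega (-α) (t - s)|) * (θ / 2 * ‖V s‖ ^ 2 + ‖e‖ ^ 2 / (2 * θ)) :=
      mul_le_mul (hR s hs) hyoung (by positivity) (by positivity)
    _ = _ := by ring

end Young

/-! ## Stability and the energy estimate in a Hilbert space -/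

section Energy

variable {H : Type*} [NormedAddCommGroup H] [InnerProductSpace ℝ H]
  {G : Type*} [NormedAddCommGroup G] [InnerProductSpace ℝ G]
  {α : ℝ} {p n : ℕ} {b : ℕ → ℝ}

theorem omega_pos {α : ℝ} (hα : α < 1) {t : ℝ} (ht : 0 < t) : 0 < omega (1 - α) t := by
  rw [omega_eq]
  exact div_pos (Real.rpow_pos_of_pos ht _) (Real.Gamma_pos_of_pos (by linarith))

theorem FracRegular.integrableOn {x : ℝ} {B : Set ℝ} {v : ℝ → H} (hv : FracRegular α x B v) :
    IntegrableOn v (Ioc 0 x) := by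
  obtain ⟨M, hM⟩ := hv.bdd
  refine Integrable.mono' (integrable_const M) hv.meas ?_
  filter_upwards [ae_restrict_mem measurableSet_Ioc] with t ht using hM t ht

theorem omega_mul_integral_normSq_le (hα0 : 0 < α) (hα : α < 1) (hb0 : b 0 = 0)
    (hb : Monotone b) {v : ℝ → H} (hv : PiecewisePoly p b n v) :
    omega (1 - α) (b n) * ∫ t in (0 : ℝ)..b n, ‖v t‖ ^ 2 ≤
      ∫ t in (0 : ℝ)..b n, omega (1 - α) t * ‖v t‖ ^ 2 := by
  have hn : 0 ≤ b n := hb0 ▸ hb (Nat.zero_le n)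
  rw [← intervalIntegral.integral_const_mul]
  refine intervalIntegral.integral_mono_on_of_le_Ioo hn ?_ ?_ fun t ht => ?_
  · exact ((intervalIntegrable_iff_integrableOn_Ioc_of_le hn).2
      (hv.normSq.fracRegular hα hb0 hb).integrableOn).const_mul _
  · exact (intervalIntegrable_iff_integrableOn_Ioc_of_le hn).2
      (hv.integrableOn_omega_normSq hα hb0 hb)
  · exact mul_le_mul_of_nonneg_right (omega_anti hα0 hα ht.1 ht.2.le) (by positivity)

variable [CompleteSpace H]

/-- Test with `u` itself, sum over the cells, discard the gradient term and use coercivity. The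
weight `ω_{1-α}(t)` is kept in the absorbing term because `ω_{1-α}` need not be square integrable,
so the initial-data term cannot be treated like `f`. -/
theorem PiecewisePoly.stability (hα0 : 0 < α) (hα : α < 1) (hb0 : b 0 = 0)
    (hb : Monotone b) (hbn : 0 < b n) {u : ℝ → H} (hu : PiecewisePoly p b n u) {g : ℝ → G}
    (hg : PiecewisePoly p b n g) {f : ℝ → H} (hf : MemLp f 2 (volume.restrict (Ioc 0 (b n))))
    (u₀ : H)
    (heq : ∀ m < n,
      (∫ t in b m..b (m + 1), (inner ℝ (rlDeriv α 0 u t) (u t) + inner ℝ (g t) (g t))) =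
        ∫ t in b m..b (m + 1), inner ℝ (f t + omega (1 - α) t • u₀) (u t)) :
    (∫ t in (0 : ℝ)..b n, ‖u t‖ ^ 2) ≤ 8 / omega (1 - α) (b n) *
      ((∫ t in (0 : ℝ)..b n, ‖f t‖ ^ 2) / omega (1 - α) (b n) +
        ‖u₀‖ ^ 2 * ∫ t in (0 : ℝ)..b n, omega (1 - α) t) := by
  set κ := omega (1 - α) (b n) with hκ
  have hκ0 : 0 < κ := omega_pos hα hbn
  have iff {E : Type _} [NormedAddCommGroup E] (F : ℝ → E) :=
    intervalIntegrable_iff_integrableOn_Ioc_of_le (f := F) (μ := volume) hbn.le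
  have ru := hu.fracRegular hα hb0 hb
  have i1 := (iff _).2 (hu.integrableOn_inner_rlDeriv hα hb0 hb hu)
  have i2 : IntervalIntegrable (fun t => inner ℝ (g t) (g t)) volume 0 (b n) := by
    simp only [real_inner_self_eq_norm_sq]
    exact (iff _).2 (hg.normSq.fracRegular hα hb0 hb).integrableOn
  have i3 : IntervalIntegrable (fun t => inner ℝ (f t + omega (1 - α) t • u₀) (u t))
      volume 0 (b n) := by
    refine (iff _).2 (integrableOn_inner_of_bdd measurableSet_Ioc ?_ ru.bdd ru.meas)
    refine (hf.integrable (by norm_num)).add ?_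
    exact (intervalIntegrable_omega hα 0 (b n)).1.smul_const u₀
  have i4 := (iff _).2 (hu.integrableOn_omega_normSq hα hb0 hb)
  have i5 : IntervalIntegrable (fun t => ‖f t‖ ^ 2) volume 0 (b n) :=
    (iff _).2 ((memLp_two_iff_integrable_sq_norm hf.aestronglyMeasurable).1 hf)
  have hsub : ∀ m < n, uIcc (b m) (b (m + 1)) ⊆ uIcc 0 (b n) := fun m hm => by
    rw [uIcc_of_le (hb m.le_succ), uIcc_of_le hbn.le, ← hb0]
    exact Icc_subset_Icc (hb (Nat.zero_le m)) (hb hm)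
  have htot : (∫ t in (0 : ℝ)..b n,
      (inner ℝ (rlDeriv α 0 u t) (u t) + inner ℝ (g t) (g t))) =
        ∫ t in (0 : ℝ)..b n, inner ℝ (f t + omega (1 - α) t • u₀) (u t) := by
    have h := Finset.sum_congr (rfl : Finset.range n = _) fun m hm => heq m (Finset.mem_range.1 hm)
    rwa [intervalIntegral.sum_integral_adjacent_intervals
        fun m hm => (i1.add i2).mono_set (hsub m hm),
      intervalIntegral.sum_integral_adjacent_intervals fun m hm => i3.mono_set (hsub m hm),
      hb0] at h
  rw [intervalIntegral.integral_add i1 i2] at htot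
  have hg0 : 0 ≤ ∫ t in (0 : ℝ)..b n, inner ℝ (g t) (g t) :=
    intervalIntegral.integral_nonneg hbn.le fun t _ => real_inner_self_nonneg
  have hco := hu.integral_inner_rlDeriv_ge hα0 hα hb0 hb
  have i6 := ((i5.const_mul (2 / κ)).add
    (((intervalIntegrable_omega hα 0 (b n)).const_mul (2 * ‖u₀‖ ^ 2)))).add (i4.const_mul (1 / 4))
  -- Each of the two Young inequalities leaves at most `ω_{1-α}(t)‖u‖²/8`. Together that is half of
  -- the coercive term `ω_{1-α}(t)‖u‖²/2`, and the remaining quarter produces the factor 8.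
  have hload : (∫ t in (0 : ℝ)..b n, inner ℝ (f t + omega (1 - α) t • u₀) (u t)) ≤
      ∫ t in (0 : ℝ)..b n, (2 / κ * ‖f t‖ ^ 2 + 2 * ‖u₀‖ ^ 2 * omega (1 - α) t +
        1 / 4 * (omega (1 - α) t * ‖u t‖ ^ 2)) := by
    refine intervalIntegral.integral_mono_on_of_le_Ioo hbn.le i3 i6 fun t ht => ?_
    rw [inner_add_left, inner_smul_left, RCLike.conj_to_real]
    have hω : κ ≤ omega (1 - α) t := omega_anti hα0 hα ht.1 ht.2.le
    have h1 : inner ℝ (f t) (u t) ≤ 2 / κ * ‖f t‖ ^ 2 + κ / 8 * ‖u t‖ ^ 2 := by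
      have h := real_inner_le_norm (f t) (u t)
      have : 2 / κ * ‖f t‖ ^ 2 + κ / 8 * ‖u t‖ ^ 2 - ‖f t‖ * ‖u t‖ =
          (4 * ‖f t‖ - κ * ‖u t‖) ^ 2 / (8 * κ) := by field_simp; ring
      have : 0 ≤ (4 * ‖f t‖ - κ * ‖u t‖) ^ 2 / (8 * κ) := by positivity
      linarith
    have h2 : inner ℝ u₀ (u t) ≤ 2 * ‖u₀‖ ^ 2 + ‖u t‖ ^ 2 / 8 := by
      have h := real_inner_le_norm u₀ (u t)
      nlinarith [sq_nonneg (4 * ‖u₀‖ - ‖u t‖)]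
    have h3 := mul_le_mul_of_nonneg_left h2 (hκ0.le.trans hω)
    have h4 := mul_le_mul_of_nonneg_right hω (by positivity : 0 ≤ ‖u t‖ ^ 2)
    linarith
  rw [intervalIntegral.integral_add ((i5.const_mul (2 / κ)).add
    (((intervalIntegrable_omega hα 0 (b n)).const_mul (2 * ‖u₀‖ ^ 2)))) (i4.const_mul (1 / 4)),
    intervalIntegral.integral_add (i5.const_mul (2 / κ))
    (((intervalIntegrable_omega hα 0 (b n)).const_mul (2 * ‖u₀‖ ^ 2))),
    intervalIntegral.integral_const_mul, intervalIntegral.integral_const_mul,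
    intervalIntegral.integral_const_mul] at hload
  have hlow := omega_mul_integral_normSq_le hα0 hα hb0 hb hu
  rw [← hκ] at hlow
  have hfin : κ * ∫ t in (0 : ℝ)..b n, ‖u t‖ ^ 2 ≤
      8 * ((∫ t in (0 : ℝ)..b n, ‖f t‖ ^ 2) / κ +
        ‖u₀‖ ^ 2 * ∫ t in (0 : ℝ)..b n, omega (1 - α) t) := by
    have : 2 / κ * (∫ t in (0 : ℝ)..b n, ‖f t‖ ^ 2) =
      2 * ((∫ t in (0 : ℝ)..b n, ‖f t‖ ^ 2) / κ) := by ring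
    linarith
  rw [div_mul_eq_mul_div, le_div_iff₀ hκ0]
  linarith

/-- The energy estimate on one cell for the difference of the two schemes: the right-hand side
collects the effect of the perturbation `R - ω_{-α}` of the kernel. -/
theorem cell_energy_le (hα0 : 0 < α) (hα : α < 1) (hb0 : b 0 = 0) (hb : Monotone b)
    {δ η θ : ℝ} (hδ : 0 < δ) (hθ : 0 < θ) (hη : 0 ≤ η) {u v : ℝ → H} {gu gv : ℝ → G}
    (hu : PiecewisePoly p b n u) (hv : PiecewisePoly p b n v) (hgu : PiecewisePoly p b n gu)
    (hgv : PiecewisePoly p b n gv) {k : ℕ} (hk : k + 2 ≤ n) (hgap : δ ≤ b (k + 1) - b k)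
    {Q : ℕ} {w lam : Fin Q → ℝ}
    (hR : ∀ y, δ ≤ y → y ≤ b n →
      |omega (-α) y - ∑ j, w j * Real.exp (-(lam j) * y)| ≤ η * |omega (-α) y|) {L : ℝ}
    (h1 : (∫ t in b (k + 1)..b (k + 2),
      (inner ℝ (rlDeriv α 0 u t) (u t - v t) + inner ℝ (gu t) (gu t - gv t))) = L)
    (h2 : (∫ t in b (k + 1)..b (k + 2), inner ℝ (rlDeriv α (b k) v t) (u t - v t)) +
      (∑ j, w j * Real.exp (-(lam j) * (b (k + 1) - b k)) *
        inner ℝ (∫ t in b (k + 1)..b (k + 2), Real.exp (-(lam j) * (t - b (k + 1))) • (u t - v t))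
          (∫ s in (0 : ℝ)..b k, Real.exp (-(lam j) * (b k - s)) • v s)) +
      (∫ t in b (k + 1)..b (k + 2), inner ℝ (gv t) (gu t - gv t)) = L) :
    (∫ t in b (k + 1)..b (k + 2), inner ℝ (rlDeriv α 0 (fun t => u t - v t) t) (u t - v t)) ≤
      ∫ t in b (k + 1)..b (k + 2),
        η * (θ / 2 * kernelAvg α δ ((Ioc 0 (b n)).indicator fun s => ‖v s‖ ^ 2) t +
          omega (1 - α) δ / (2 * θ) * ‖u t - v t‖ ^ 2) := by
  have hpos : ∀ m, 0 ≤ b m := fun m => hb0 ▸ hb (Nat.zero_le m)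
  have he : PiecewisePoly p b n fun t => u t - v t := fun m hm => (hu m hm).sub (hv m hm)
  have hge : PiecewisePoly p b n fun t => gu t - gv t := fun m hm => (hgu m hm).sub (hgv m hm)
  have ru := hu.fracRegular hα hb0 hb
  have rv := hv.fracRegular hα hb0 hb
  have re := he.fracRegular hα hb0 hb
  have hcd : b (k + 1) ≤ b (k + 2) := hb (Nat.le_succ _)
  have hk1 : b k < b (k + 1) := by linarith
  have hsub : Ioc (b (k + 1)) (b (k + 2)) ⊆ Ioc 0 (b n) := Ioc_subset_Ioc (hpos _) (hb hk)
  have hsubk : Ioc (b (k + 1)) (b (k + 2)) ⊆ Ioc (b k) (b n) :=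
    Ioc_subset_Ioc hk1.le (hb hk)
  have toI {F : ℝ → ℝ} (hF : IntegrableOn F (Ioc (b (k + 1)) (b (k + 2)))) :
      IntervalIntegrable F volume (b (k + 1)) (b (k + 2)) :=
    (intervalIntegrable_iff_integrableOn_Ioc_of_le hcd).2 hF
  have hgi : ∀ g : ℝ → G, PiecewisePoly p b n g →
      IntervalIntegrable (fun t => inner ℝ (g t) (gu t - gv t)) volume (b (k + 1)) (b (k + 2)) := by
    intro g hg
    have : PiecewisePoly (p + p) b n fun t => inner ℝ (g t) (gu t - gv t) :=
      fun m hm => (hg m hm).inner (hge m hm)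
    exact toI ((this.fracRegular hα hb0 hb).integrableOn.mono_set hsub)
  have iu := toI ((hu.integrableOn_inner_rlDeriv hα hb0 hb he).mono_set hsub)
  have ie := toI ((he.integrableOn_inner_rlDeriv hα hb0 hb he).mono_set hsub)
  have iloc : IntervalIntegrable (fun t => inner ℝ (rlDeriv α (b k) v t) (u t - v t)) volume
      (b (k + 1)) (b (k + 2)) := by
    refine toI (integrableOn_inner_of_bdd measurableSet_Ioc
      ((hv.integrableOn_local hα hb0 hb).mono_set hsubk) ?_ (re.meas.mono_set hsub))
    obtain ⟨M, hM⟩ := re.bdd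
    exact ⟨M, fun t ht => hM t (hsub ht)⟩
  have iv : IntervalIntegrable v volume 0 (b k) :=
    (intervalIntegrable_iff_integrableOn_Ioc_of_le (hpos k)).2
      (rv.integrableOn.mono_set (Ioc_subset_Ioc_right (hb (by omega))))
  have iX : IntervalIntegrable (fun t => u t - v t) volume (b (k + 1)) (b (k + 2)) :=
    (intervalIntegrable_iff_integrableOn_Ioc_of_le hcd).2 (re.integrableOn.mono_set hsub)
  rw [sum_moment_history w lam iv iX] at h2
  set kap : ℝ → ℝ := fun y => ∑ j, w j * Real.exp (-(lam j) * y) with hkap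
  have hkapc : Continuous kap := by rw [hkap]; fun_prop
  have ihist : IntervalIntegrable
      (fun t => inner ℝ (∫ s in (0 : ℝ)..b k, kap (t - s) • v s) (u t - v t)) volume
      (b (k + 1)) (b (k + 2)) := by
    simp only [hkap, integral_expSum_smul w lam iv, sum_inner, inner_smul_left,
      RCLike.conj_to_real]
    have h := IntervalIntegrable.sum Finset.univ fun j _ =>
      (intervalIntegrable_inner_history (a := b k) (μ := lam j) (V := v) iX).const_mul (w j)
    simpa only [Finset.sum_fn] using h
  set M : ℝ → ℝ := fun t =>
    η * (θ / 2 * kernelAvg α δ ((Ioc 0 (b n)).indicator fun s => ‖v s‖ ^ 2) t +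
      omega (1 - α) δ / (2 * θ) * ‖u t - v t‖ ^ 2) with hM
  have iM : IntervalIntegrable M volume (b (k + 1)) (b (k + 2)) := by
    have j1 : Integrable ((Ioc 0 (b n)).indicator fun s => ‖v s‖ ^ 2) :=
      IntegrableOn.integrable_indicator (hv.normSq.fracRegular hα hb0 hb).integrableOn
        measurableSet_Ioc
    have j2 := toI (integrable_kernelAvg hα0 hα hδ j1).integrableOn
    have j3 := toI ((he.normSq.fracRegular hα hb0 hb).integrableOn.mono_set hsub)
    exact ((j2.const_mul _).add (j3.const_mul _)).const_mul _
  -- The right-hand integrand is the difference of the two schemes tested with `u - v`, so it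
  -- integrates to `L - L = 0`. The pointwise inequality discards `‖gu - gv‖²` and bounds the kernel
  -- error by `M`.
  have key : (∫ t in b (k + 1)..b (k + 2),
      (inner ℝ (rlDeriv α 0 (fun t => u t - v t) t) (u t - v t) - M t)) ≤
      ∫ t in b (k + 1)..b (k + 2),
        (((inner ℝ (rlDeriv α 0 u t) (u t - v t) + inner ℝ (gu t) (gu t - gv t)) -
          (inner ℝ (rlDeriv α (b k) v t) (u t - v t) +
            inner ℝ (∫ s in (0 : ℝ)..b k, kap (t - s) • v s) (u t - v t))) -
          inner ℝ (gv t) (gu t - gv t)) := by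
    refine intervalIntegral.integral_mono_ae_restrict hcd (ie.sub iM)
      (((iu.add (hgi gu hgu)).sub (iloc.add ihist)).sub (hgi gv hgv)) ?_
    rw [EventuallyLE, ← Measure.restrict_congr_set Ioc_ae_eq_Icc]
    filter_upwards [ae_mem_Ioo_not_mem (b := b)] with t ht
    have ht0 : t ∈ Ioo 0 (b n) := ⟨(hpos _).trans_lt ht.1.1, ht.1.2.trans_le (hb hk)⟩
    have hkt : b k < t := hk1.trans ht.1.1
    have hdu := ru.hasDerivAt ht0 ht.2
    have hdv := rv.hasDerivAt ht0 ht.2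
    have hde : rlDeriv α 0 (fun t => u t - v t) t = rlDeriv α 0 u t - rlDeriv α 0 v t := by
      rw [rlDeriv_zero]
      refine HasDerivAt.deriv ((hdu.sub hdv).congr_of_eventuallyEq ?_)
      filter_upwards [Ioo_mem_nhds ht0.1 ht0.2] with x hx
      have := fracInt_add hα ru (rv.const_smul (-1)) (Ioo_subset_Icc_self hx)
      rw [fracInt_const_smul] at this
      simpa [← sub_eq_add_neg] using this
    have hsplit := hv.rlDeriv_split hα0 hα hb0 hb ht0 ht.2 hkt
    have hωc : ContinuousOn (fun s => omega (-α) (t - s)) (uIcc 0 (b k)) := by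
      unfold omega
      refine ContinuousOn.div_const (ContinuousOn.rpow_const (by fun_prop) fun s hs => Or.inl ?_) _
      rw [uIcc_of_le (hpos k)] at hs
      linarith [hs.2]
    have hhist : (∫ s in (0 : ℝ)..b k, (kap (t - s) - omega (-α) (t - s)) • v s) =
        (∫ s in (0 : ℝ)..b k, kap (t - s) • v s) -
          ∫ s in (0 : ℝ)..b k, omega (-α) (t - s) • v s := by
      rw [← intervalIntegral.integral_sub (iv.continuousOn_smul (by fun_prop))
        (iv.continuousOn_smul hωc)]
      simp only [sub_smul]
    -- The history ends at `b k` while `t > b (k + 1)`, so every lag is at least the gap, hence at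
    -- least `δ`, where the kernel approximation holds.
    have hle := inner_history_le (η := η) (θ := θ) (R := fun y => kap y - omega (-α) y)
      (a := b k) (B := b n) (t := t) (V := v) hα0 hα hδ hθ hη
      (hb (by omega)) (hpos k) (by linarith [ht.1.1]) (fun s hs => by
        rw [abs_sub_comm]
        exact hR (t - s) (by linarith [ht.1.1, hs.2]) (by linarith [ht0.2, hs.1])) rv.bdd rv.meas
      (u t - v t)
    have hgn : 0 ≤ inner ℝ (gu t - gv t) (gu t - gv t) := real_inner_self_nonneg
    rw [inner_sub_left] at hgn
    simp only [hhist] at hle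
    rw [inner_sub_left] at hle
    rw [hde, hsplit, inner_sub_left, inner_add_left]
    simp only [hM]
    linarith
  rw [intervalIntegral.integral_sub ie iM, intervalIntegral.integral_sub
    ((iu.add (hgi gu hgu)).sub (iloc.add ihist)) (hgi gv hgv), intervalIntegral.integral_sub
    (iu.add (hgi gu hgu)) (iloc.add ihist), intervalIntegral.integral_add iloc ihist] at key
  linarith

/-- If the energy of `u - v` on each cell is controlled by the perturbation terms, then `u - v` is
small in `L²` compared with `u`. -/
theorem integral_normSq_sub_le (hα0 : 0 < α) (hα : α < 1) (hb0 : b 0 = 0) (hb : Monotone b)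
    {δ η : ℝ} (hδ : 0 < δ) (hη : 0 < η) (hbn : 0 < b n) {u v : ℝ → H}
    (hu : PiecewisePoly p b n u) (hv : PiecewisePoly p b n v)
    (hsmall : 6 * (η * omega (1 - α) δ) ≤ omega (1 - α) (b n))
    (hcell : ∀ θ > 0, ∀ m < n,
      (∫ t in b m..b (m + 1), inner ℝ (rlDeriv α 0 (fun t => u t - v t) t) (u t - v t)) ≤
      ∫ t in b m..b (m + 1),
        η * (θ / 2 * kernelAvg α δ ((Ioc 0 (b n)).indicator fun s => ‖v s‖ ^ 2) t +
          omega (1 - α) δ / (2 * θ) * ‖u t - v t‖ ^ 2)) :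
    (∫ t in (0 : ℝ)..b n, ‖u t - v t‖ ^ 2) ≤
      (4 * (η * omega (1 - α) δ) / omega (1 - α) (b n)) ^ 2 *
        ∫ t in (0 : ℝ)..b n, ‖u t‖ ^ 2 := by
  set κ := omega (1 - α) (b n) with hκ
  set ρ := η * omega (1 - α) δ with hρ
  have hκ0 : 0 < κ := omega_pos hα hbn
  have hρ0 : 0 < ρ := mul_pos hη (omega_pos hα hδ)
  -- This weight makes the `‖u - v‖²` term of Young's inequality equal to `κ/8`, a quarter of the
  -- coercivity constant `κ/2`.
  set θ := 4 * ρ / κ with hθ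
  have hθ0 : 0 < θ := by positivity
  have he : PiecewisePoly p b n fun t => u t - v t := fun m hm => (hu m hm).sub (hv m hm)
  have iff (F : ℝ → ℝ) :=
    intervalIntegrable_iff_integrableOn_Ioc_of_le (f := F) (μ := volume) hbn.le
  have i1 := (iff _).2 (he.integrableOn_inner_rlDeriv hα hb0 hb he)
  have i2 := (iff _).2 (he.normSq.fracRegular hα hb0 hb).integrableOn
  have iu := (iff _).2 (hu.normSq.fracRegular hα hb0 hb).integrableOn
  have iv := (iff _).2 (hv.normSq.fracRegular hα hb0 hb).integrableOn
  have hφ : Integrable ((Ioc 0 (b n)).indicator fun s => ‖v s‖ ^ 2) :=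
    IntegrableOn.integrable_indicator (hv.normSq.fracRegular hα hb0 hb).integrableOn
      measurableSet_Ioc
  have ik := integrable_kernelAvg hα0 hα hδ hφ
  have i3 : IntervalIntegrable (kernelAvg α δ ((Ioc 0 (b n)).indicator fun s => ‖v s‖ ^ 2))
      volume 0 (b n) := (iff _).2 ik.integrableOn
  have i4 := ((i3.const_mul (θ / 2)).add
    (i2.const_mul (omega (1 - α) δ / (2 * θ)))).const_mul η
  have hsub : ∀ m < n, uIcc (b m) (b (m + 1)) ⊆ uIcc 0 (b n) := fun m hm => by
    rw [uIcc_of_le (hb m.le_succ), uIcc_of_le hbn.le, ← hb0]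
    exact Icc_subset_Icc (hb (Nat.zero_le m)) (hb hm)
  have htot := Finset.sum_le_sum fun m hm => hcell θ hθ0 m (Finset.mem_range.1 hm)
  rw [intervalIntegral.sum_integral_adjacent_intervals fun m hm => i1.mono_set (hsub m hm),
    intervalIntegral.sum_integral_adjacent_intervals fun m hm => i4.mono_set (hsub m hm), hb0,
    intervalIntegral.integral_const_mul, intervalIntegral.integral_add (i3.const_mul _)
      (i2.const_mul _), intervalIntegral.integral_const_mul,
    intervalIntegral.integral_const_mul] at htot
  have hco := he.integral_inner_rlDeriv_ge hα0 hα hb0 hb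
  have hlow := omega_mul_integral_normSq_le hα0 hα hb0 hb he
  -- Young's convolution bound: extending the integral to the whole line costs nothing by
  -- positivity, and there it is the product of the two masses.
  have hk : (∫ t in (0 : ℝ)..b n,
      kernelAvg α δ ((Ioc 0 (b n)).indicator fun s => ‖v s‖ ^ 2) t) ≤
      (∫ t in (0 : ℝ)..b n, ‖v t‖ ^ 2) * omega (1 - α) δ := by
    rw [intervalIntegral.integral_of_le hbn.le, intervalIntegral.integral_of_le hbn.le,
      ← integral_indicator measurableSet_Ioc (f := fun t => ‖v t‖ ^ 2),
      ← integral_kernelAvg hα0 hα hδ hφ]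
    exact setIntegral_le_integral ik (ae_of_all _ fun t => kernelAvg_nonneg
      (fun s => indicator_nonneg (fun _ _ => by positivity) s) t)
  have hv2 : (∫ t in (0 : ℝ)..b n, ‖v t‖ ^ 2) ≤
      2 * (∫ t in (0 : ℝ)..b n, ‖u t‖ ^ 2) + 2 * ∫ t in (0 : ℝ)..b n, ‖u t - v t‖ ^ 2 := by
    rw [← intervalIntegral.integral_const_mul, ← intervalIntegral.integral_const_mul,
      ← intervalIntegral.integral_add (iu.const_mul 2) (i2.const_mul 2)]
    refine intervalIntegral.integral_mono_on hbn.le iv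
      ((iu.const_mul 2).add (i2.const_mul 2)) fun t _ => ?_
    have h1 : ‖v t‖ ≤ ‖u t‖ + ‖u t - v t‖ := by
      have := norm_sub_le (u t) (u t - v t)
      rwa [sub_sub_cancel] at this
    nlinarith [norm_nonneg (v t), sq_nonneg (‖u t‖ - ‖u t - v t‖)]
  set A := ∫ t in (0 : ℝ)..b n, ‖u t - v t‖ ^ 2 with hA
  set Bu := ∫ t in (0 : ℝ)..b n, ‖u t‖ ^ 2 with hBu
  set Bv := ∫ t in (0 : ℝ)..b n, ‖v t‖ ^ 2 with hBv
  have hA0 : 0 ≤ A := intervalIntegral.integral_nonneg hbn.le fun t _ => by positivity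
  rw [← hκ] at hlow
  have e1 : κ / 2 * A ≤ ρ * θ / 2 * (2 * Bu + 2 * A) + ρ / (2 * θ) * A := by
    have a1 := mul_le_mul_of_nonneg_left hk (by positivity : 0 ≤ η * (θ / 2))
    have a2 := mul_le_mul_of_nonneg_left hv2 (by positivity : 0 ≤ ρ * θ / 2)
    have a3 : η * (θ / 2) * (Bv * omega (1 - α) δ) = ρ * θ / 2 * Bv := by rw [hρ]; ring
    have a4 : η * (omega (1 - α) δ / (2 * θ) * A) = ρ / (2 * θ) * A := by rw [hρ]; ring
    linarith
  have e2 : ρ / (2 * θ) = κ / 8 := by rw [hθ]; field_simp; ring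
  have e3 : ρ * θ / 2 = 2 * ρ ^ 2 / κ := by rw [hθ]; field_simp; ring
  -- Here `6ρ ≤ κ` enters, through `32 ≤ 36`. Of `κ/2`, two eighths are now absorbed and `κ/4`
  -- remains.
  have e4 : 4 * ρ ^ 2 / κ ≤ κ / 8 := by
    rw [div_le_iff₀ hκ0]
    nlinarith
  rw [e2, e3] at e1
  have e5 := mul_le_mul_of_nonneg_right e4 hA0
  have e6 : κ / 4 * A ≤ 4 * ρ ^ 2 / κ * Bu := by
    have : 2 * ρ ^ 2 / κ * (2 * Bu + 2 * A) = 4 * ρ ^ 2 / κ * Bu + 4 * ρ ^ 2 / κ * A := by ring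
    linarith
  have e7 : (4 * ρ / κ) ^ 2 * Bu = 4 / κ * (4 * ρ ^ 2 / κ * Bu) := by field_simp
  rw [e7]
  calc A = 4 / κ * (κ / 4 * A) := by field_simp
    _ ≤ _ := mul_le_mul_of_nonneg_left e6 (by positivity)

end Energy

/-! ## The graded mesh -/

section Mesh

variable {r T : ℝ} {N : ℕ}

theorem mesh_zero (hr : 1 ≤ r) : mesh r T N 0 = 0 := by
  rw [mesh, Nat.cast_zero, zero_div, Real.zero_rpow (by linarith), zero_mul]

theorem mesh_monotone (hr : 1 ≤ r) (hT : 0 < T) : Monotone (mesh r T N) := fun m n hmn => by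
  refine mul_le_mul_of_nonneg_right (Real.rpow_le_rpow (by positivity) ?_ (by linarith)) hT.le
  exact div_le_div_of_nonneg_right (Nat.cast_le.2 hmn) (Nat.cast_nonneg N)

theorem mesh_last (hN : 1 ≤ N) : mesh r T N N = T := by
  have : (N : ℝ) ≠ 0 := by positivity
  rw [mesh, div_self this, Real.one_rpow, one_mul]

theorem mesh_pos (hT : 0 < T) (hN : 1 ≤ N) {n : ℕ} (hn : 1 ≤ n) : 0 < mesh r T N n := by
  have : 0 < (n : ℝ) / N := by positivity
  exact mul_pos (Real.rpow_pos_of_pos this _) hT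

/-- Superadditivity of `x ↦ x^r` for `r ≥ 1`: the first cell of the graded mesh is the shortest. -/
theorem mesh_one_le_sub (hr : 1 ≤ r) (hT : 0 < T) (n : ℕ) :
    mesh r T N 1 ≤ mesh r T N (n + 1) - mesh r T N n := by
  have h := Real.add_rpow_le_rpow_add (a := (n : ℝ) / N) (b := 1 / N) (by positivity)
    (by positivity) hr
  rw [← add_div] at h
  have := mul_le_mul_of_nonneg_right h hT.le
  simp only [mesh, Nat.cast_add, Nat.cast_one]
  linarith

theorem mesh_rpow_mul {α : ℝ} (hT : 0 < T) (hN : 1 ≤ N) {n : ℕ} :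
    mesh r T N n ^ α * mesh r T N 1 ^ (-α) = (n : ℝ) ^ (r * α) := by
  have hN0 : 0 < (N : ℝ) := by positivity
  have hn : 0 ≤ (n : ℝ) := by positivity
  have h1 : mesh r T N n ^ α = (n : ℝ) ^ (r * α) / (N : ℝ) ^ (r * α) * T ^ α := by
    rw [mesh, Real.mul_rpow (Real.rpow_nonneg (by positivity) _) hT.le,
      ← Real.rpow_mul (by positivity), Real.div_rpow hn hN0.le]
  have h2 : mesh r T N 1 ^ (-α) = (N : ℝ) ^ (r * α) * (T ^ α)⁻¹ := by
    rw [mesh, Real.mul_rpow (Real.rpow_nonneg (by positivity) _) hT.le,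
      ← Real.rpow_mul (by positivity), Nat.cast_one, one_div, Real.inv_rpow hN0.le,
      mul_neg, Real.rpow_neg hN0.le, inv_inv, Real.rpow_neg hT.le]
  have h3 := (Real.rpow_pos_of_pos hN0 (r * α)).ne'
  have h4 := (Real.rpow_pos_of_pos hT α).ne'
  rw [h1, h2]
  field_simp

end Mesh

/-! ## The two schemes -/

section Schemes

variable {d : ℕ} {Ω : Set (EuclideanSpace ℝ (Fin d))}

/-- The embedding of `H₀¹(Ω)` into `L²(Ω)`, as a linear map. -/
noncomputable def toL2Lin : H01 Ω →ₗ[ℝ] L2 Ω :=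
  LinearMap.fst ℝ (L2 Ω) (L2Vec Ω) ∘ₗ (H01 Ω).subtype

/-- The weak gradient, as a linear map. -/
noncomputable def gradLin : H01 Ω →ₗ[ℝ] L2Vec Ω :=
  LinearMap.snd ℝ (L2 Ω) (L2Vec Ω) ∘ₗ (H01 Ω).subtype

theorem toL2_sub (x y : H01 Ω) : toL2 (x - y) = toL2 x - toL2 y := toL2Lin.map_sub x y

theorem grad_sub (x y : H01 Ω) : grad (x - y) = grad x - grad y := gradLin.map_sub x y

theorem PiecewisePoly.toL2 {p n : ℕ} {b : ℕ → ℝ} {U : ℝ → H01 Ω} (hU : PiecewisePoly p b n U) :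
    PiecewisePoly p b n fun t => FastDG.toL2 (U t) := fun m hm => (hU m hm).map toL2Lin

theorem PiecewisePoly.grad {p n : ℕ} {b : ℕ → ℝ} {U : ℝ → H01 Ω} (hU : PiecewisePoly p b n U) :
    PiecewisePoly p b n fun t => FastDG.grad (U t) := fun m hm => (hU m hm).map gradLin

variable {α r T : ℝ} {p N : ℕ} {u₀ : L2 Ω} {f : ℝ → L2 Ω} {U V : ℝ → H01 Ω}

theorem IsDG.piecewisePoly (hU : IsDG α r T p N u₀ f U) : PiecewisePoly p (mesh r T N) N U :=
  fun m hm => hU.1 (m + 1) (Nat.le_add_left 1 m) hm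

theorem IsFastDG.piecewisePoly {Q : ℕ} {w lam : Fin Q → ℝ} (hU : IsDG α r T p N u₀ f U)
    (hV : IsFastDG α r T p N u₀ f w lam U V) : PiecewisePoly p (mesh r T N) N V := fun m hm => by
  rcases le_or_gt (m + 1) 2 with h | h
  · exact (hU.piecewisePoly m hm).congr (hV.1 (m + 1) (Nat.le_add_left 1 m) hm h)
  · exact hV.2.1 (m + 1) h hm

theorem IsDG.integral_normSq_le (hα0 : 0 < α) (hα : α < 1) (hr : 1 ≤ r) (hT : 0 < T) (hN : 1 ≤ N)
    (hf : MemLp f 2 (volume.restrict (Ioc 0 T))) (hU : IsDG α r T p N u₀ f U) :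
    (∫ t in (0 : ℝ)..T, ‖toL2 (U t)‖ ^ 2) ≤ 8 / omega (1 - α) T *
      ((∫ t in (0 : ℝ)..T, ‖f t‖ ^ 2) / omega (1 - α) T +
        ‖u₀‖ ^ 2 * ∫ t in (0 : ℝ)..T, omega (1 - α) t) := by
  have h := hU.piecewisePoly.toL2.stability (f := f) hα0 hα (mesh_zero hr) (mesh_monotone hr hT)
    (mesh_pos hT hN hN) hU.piecewisePoly.grad (by rwa [mesh_last hN]) u₀
    fun m hm => hU.2 (m + 1) (Nat.le_add_left 1 m) hm U (hU.piecewisePoly m hm)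
  rwa [mesh_last hN] at h

theorem IsFastDG.cell_energy {Q : ℕ} {w lam : Fin Q → ℝ} (hα0 : 0 < α) (hα : α < 1) (hr : 1 ≤ r)
    (hT : 0 < T) (hN : 1 ≤ N) {η θ : ℝ} (hθ : 0 < θ) (hη : 0 ≤ η)
    (hR : KernelApprox α (mesh r T N 1) T η w lam) (hU : IsDG α r T p N u₀ f U)
    (hV : IsFastDG α r T p N u₀ f w lam U V) {n : ℕ} (hn : n ≤ N) {m : ℕ} (hm : m < n) :
    (∫ t in mesh r T N m..mesh r T N (m + 1),
      inner ℝ (rlDeriv α 0 (fun t => toL2 (U t) - toL2 (V t)) t) (toL2 (U t) - toL2 (V t))) ≤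
    ∫ t in mesh r T N m..mesh r T N (m + 1),
      η * (θ / 2 * kernelAvg α (mesh r T N 1)
        ((Ioc 0 (mesh r T N n)).indicator fun s => ‖toL2 (V s)‖ ^ 2) t +
      omega (1 - α) (mesh r T N 1) / (2 * θ) * ‖toL2 (U t) - toL2 (V t)‖ ^ 2) := by
  have hmono := mesh_monotone (N := N) hr hT
  rcases le_or_gt (m + 1) 2 with h | h
  -- On the first two cells the schemes coincide, so the left side is zero and the right side is
  -- nonnegative.
  · have hz : ∀ t ∈ uIoc (mesh r T N m) (mesh r T N (m + 1)), toL2 (U t) - toL2 (V t) = 0 := by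
      intro t ht
      rw [uIoc_of_le (hmono m.le_succ)] at ht
      rw [hV.1 (m + 1) (Nat.le_add_left 1 m) (by omega) h t ht, sub_self]
    rw [intervalIntegral.integral_congr_ae (g := fun _ => 0)
      (ae_of_all _ fun t ht => by rw [hz t ht, inner_zero_right]), intervalIntegral.integral_zero]
    refine intervalIntegral.integral_nonneg (hmono m.le_succ) fun t _ => ?_
    have h1 := kernelAvg_nonneg (α := α) (δ := mesh r T N 1)
      (φ := (Ioc 0 (mesh r T N n)).indicator fun s => ‖toL2 (V s)‖ ^ 2)
      (fun s => indicator_nonneg (fun _ _ => by positivity) s) t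
    have h2 := omega_nonneg hα (mesh_pos (r := r) hT hN le_rfl).le
    positivity
  · obtain ⟨k, rfl⟩ : ∃ k, m = k + 1 := ⟨m - 1, by omega⟩
    have hUV : IsPolyOn p (cell r T N (k + 2)) fun t => U t - V t :=
      (hU.piecewisePoly (k + 1) (by omega)).sub ((hV.piecewisePoly hU) (k + 1) (by omega))
    have e1 := hU.2 (k + 2) (by omega) (by omega) _ hUV
    have e2 := hV.2.2 (k + 2) (by omega) (by omega) _ hUV
    simp only [toL2_sub, grad_sub] at e1
    simp only [localPart, fastHist, testMoment, histVar, toL2_sub, grad_sub] at e2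
    refine cell_energy_le (gu := fun t => grad (U t)) (gv := fun t => grad (V t)) hα0 hα
      (mesh_zero hr) hmono (mesh_pos hT hN le_rfl) hθ hη
      (hU.piecewisePoly.mono hn).toL2 ((hV.piecewisePoly hU).mono hn).toL2
      (hU.piecewisePoly.mono hn).grad ((hV.piecewisePoly hU).mono hn).grad (by omega)
      (mesh_one_le_sub hr hT k) (fun y hy hy' => ?_) e1 e2
    exact hR y hy (hy'.trans ((hmono hn).trans_eq (mesh_last hN)))

theorem IsFastDG.integral_normSq_sub_le {Q : ℕ} {w lam : Fin Q → ℝ} {K ε : ℝ} (hα0 : 0 < α)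
    (hα : α < 1) (hr : 1 ≤ r) (hT : 0 < T) (hN : 1 ≤ N) (hK : 0 < K) (hε : 0 < ε)
    (hεN : ε ≤ 1 / (6 * K) * (N : ℝ) ^ (-(r * α)))
    (hR : KernelApprox α (mesh r T N 1) T (K * ε) w lam) (hU : IsDG α r T p N u₀ f U)
    (hV : IsFastDG α r T p N u₀ f w lam U V) {n : ℕ} (hn1 : 1 ≤ n) (hn : n ≤ N) :
    (∫ t in (0 : ℝ)..mesh r T N n, ‖toL2 (U t) - toL2 (V t)‖ ^ 2) ≤
      16 * K ^ 2 * (∫ t in (0 : ℝ)..mesh r T N n, ‖toL2 (U t)‖ ^ 2) *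
        (ε * mesh r T N n ^ α * mesh r T N 1 ^ (-α)) ^ 2 := by
  have hbn := mesh_pos (r := r) hT hN hn1
  have hb1 := mesh_pos (r := r) hT hN le_rfl
  have hG := Real.Gamma_pos_of_pos (show 0 < 1 - α by linarith)
  have hN0 : 0 < (N : ℝ) := by positivity
  have hp := Real.rpow_pos_of_pos hbn α
  -- The ratio `ρ/κ` of the energy estimate is exactly the quantity in the claimed bound.
  have hratio : K * ε * omega (1 - α) (mesh r T N 1) / omega (1 - α) (mesh r T N n) =
      K * (ε * mesh r T N n ^ α * mesh r T N 1 ^ (-α)) := by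
    rw [omega_eq, omega_eq, Real.rpow_neg hbn.le]
    field_simp
  have hle : ε * mesh r T N n ^ α * mesh r T N 1 ^ (-α) ≤ 1 / (6 * K) := by
    rw [mul_assoc, mesh_rpow_mul hT hN]
    calc ε * (n : ℝ) ^ (r * α)
        ≤ (1 / (6 * K) * (N : ℝ) ^ (-(r * α))) * (N : ℝ) ^ (r * α) := by
          refine mul_le_mul hεN ?_ (by positivity) (by positivity)
          exact Real.rpow_le_rpow (by positivity) (Nat.cast_le.2 hn) (by positivity)
      _ = 1 / (6 * K) := by
          rw [mul_assoc, ← Real.rpow_add hN0, neg_add_cancel, Real.rpow_zero, mul_one]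
  -- Since `n^{rα} ≤ N^{rα}`, the restriction on `ε` gives this absorption condition for all `n ≤ N`
  -- at once.
  have hsmall : 6 * (K * ε * omega (1 - α) (mesh r T N 1)) ≤ omega (1 - α) (mesh r T N n) := by
    have h1 : K * (ε * mesh r T N n ^ α * mesh r T N 1 ^ (-α)) ≤ 1 / 6 := by
      calc _ ≤ K * (1 / (6 * K)) := mul_le_mul_of_nonneg_left hle hK.le
        _ = 1 / 6 := by field_simp
    rw [← hratio, div_le_iff₀ (omega_pos hα hbn)] at h1
    linarith
  have h := FastDG.integral_normSq_sub_le hα0 hα (mesh_zero hr) (mesh_monotone hr hT) hb1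
    (mul_pos hK hε) hbn (hU.piecewisePoly.mono hn).toL2 ((hV.piecewisePoly hU).mono hn).toL2 hsmall
    fun θ hθ m hm => hV.cell_energy hα0 hα hr hT hN hθ (by positivity) hR hU hn hm
  rw [mul_div_assoc, hratio] at h
  refine h.trans (le_of_eq ?_)
  ring

end Schemes

end FastDG

theorem theorem3 {d : ℕ} (Ω : Set (EuclideanSpace ℝ (Fin d))) (hΩ : IsOpen Ω)
    (hΩb : Bornology.IsBounded Ω) (α r T K : ℝ) (hα0 : 0 < α) (hα1 : α < 1) (hr : 1 ≤ r)
    (hT : 0 < T) (hK : 0 < K) (p : ℕ) :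
    ∃ c : ℝ, 0 < c ∧
      ∀ (u₀ : FastDG.L2 Ω) (f : ℝ → FastDG.L2 Ω),
        MeasureTheory.MemLp f 2 (MeasureTheory.volume.restrict (Set.Ioc 0 T)) →
        ∃ C : ℝ, 0 < C ∧
          ∀ (N : ℕ) (ε : ℝ), 1 ≤ N → 0 < ε → ε ≤ c * (N : ℝ) ^ (-(r * α)) →
          ∀ (Q : ℕ) (w lam : Fin Q → ℝ),
            FastDG.KernelApprox α (FastDG.mesh r T N 1) T (K * ε) w lam →
          ∀ U V : ℝ → FastDG.H01 Ω,
            FastDG.IsDG α r T p N u₀ f U →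
            FastDG.IsFastDG α r T p N u₀ f w lam U V →
          ∀ n : ℕ, 1 ≤ n → n ≤ N →
            (∫ t in (0 : ℝ)..FastDG.mesh r T N n,
                ‖FastDG.toL2 (U t) - FastDG.toL2 (V t)‖ ^ 2)
              ≤ C * (ε * FastDG.mesh r T N n ^ α * FastDG.mesh r T N 1 ^ (-α)) ^ 2 ∧
            (ε * FastDG.mesh r T N n ^ α * FastDG.mesh r T N 1 ^ (-α)) ^ 2
              ≤ C * (ε * (n : ℝ) ^ (r * α)) ^ 2 := by
  refine ⟨1 / (6 * K), by positivity, fun u₀ f hf => ?_⟩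
  set S := 8 / FastDG.omega (1 - α) T *
    ((∫ t in (0 : ℝ)..T, ‖f t‖ ^ 2) / FastDG.omega (1 - α) T +
      ‖u₀‖ ^ 2 * ∫ t in (0 : ℝ)..T, FastDG.omega (1 - α) t) with hS
  have hω := FastDG.omega_pos hα1 hT
  have hS0 : 0 ≤ S := by
    have h1 : 0 ≤ ∫ t in (0 : ℝ)..T, ‖f t‖ ^ 2 :=
      intervalIntegral.integral_nonneg hT.le fun t _ => by positivity
    have h2 : 0 ≤ ∫ t in (0 : ℝ)..T, FastDG.omega (1 - α) t :=
      intervalIntegral.integral_nonneg hT.le fun t ht => FastDG.omega_nonneg hα1 ht.1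
    positivity
  -- `S` is the stability bound for `∫‖U‖²` over `(0, T]`. The added 1 keeps the constant positive
  -- when the data vanish and serves the second inequality.
  refine ⟨16 * K ^ 2 * S + 1, by positivity, ?_⟩
  intro N ε hN hε hεN Q w lam hR U V hU hV n hn1 hn
  constructor
  · refine (hV.integral_normSq_sub_le hα0 hα1 hr hT hN hK hε hεN hR hU hn1 hn).trans ?_
    refine mul_le_mul_of_nonneg_right ?_ (by positivity)
    have hsq : IntervalIntegrable (fun t => ‖FastDG.toL2 (U t)‖ ^ 2) MeasureTheory.volume 0 T := by
      have h := (hU.piecewisePoly.toL2.normSq.fracRegular hα1 (FastDG.mesh_zero hr)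
        (FastDG.mesh_monotone hr hT)).integrableOn
      rw [FastDG.mesh_last hN] at h
      exact (intervalIntegrable_iff_integrableOn_Ioc_of_le hT.le).2 h
    have h1 : (∫ t in (0 : ℝ)..FastDG.mesh r T N n, ‖FastDG.toL2 (U t)‖ ^ 2) ≤
        ∫ t in (0 : ℝ)..T, ‖FastDG.toL2 (U t)‖ ^ 2 :=
      intervalIntegral.integral_mono_interval le_rfl (FastDG.mesh_pos hT hN hn1).le
        ((FastDG.mesh_monotone hr hT hn).trans_eq (FastDG.mesh_last hN))
        (Filter.Eventually.of_forall fun t => sq_nonneg _) hsq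
    have h2 := h1.trans (hU.integral_normSq_le hα0 hα1 hr hT hN hf)
    have h3 := mul_le_mul_of_nonneg_left h2 (by positivity : 0 ≤ 16 * K ^ 2)
    linarith
  · rw [mul_assoc ε, FastDG.mesh_rpow_mul hT hN]
    refine le_mul_of_one_le_left (by positivity) ?_
    have : 0 ≤ 16 * K ^ 2 * S := by positivity
    linarith
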